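/- A structural matrix is a matrix with entries in $\{0,\ast\}$. Let $\mathbb{F}$ be $\mathbb{R}$ or $\mathbb{C}$. A matrix $X$ over $\mathbb{F}$ has the non-zero structure of a structural matrix $\mathcal{X}$ of the same dimensions if $X_{i,j}\neq 0$ is equivalent to $\mathcal{X}_{i,j}=\ast$ for all $i,j$. A pair of structural matrices $\mathcal{A}\in\{0,\ast\}^{n\times n}$, $\mathcal{B}\in\{0,\ast\}^{n\times r}$ is strong structurally controllable if for all matrices $A$, $B$ over $\mathbb{F}$ having the non-zero structure of $\mathcal{A}$ and $\mathcal{B}$, respectively, the system $\dot x(t)=Ax(t)+Bu(t)$ is controllable, i.e., for any initial state $x_0\in\mathbb{F}^n$ and any terminal state $x_1\in\mathbb{F}^n$ there are $T>0$ and a measurable, essentially bounded input signal $u\colon[0,T]\to\mathbb{F}^r$ that steers the system from $x_0$ at time $0$ to $x_1$ at time $T$. Let $\mathcal{X}=(\mathcal{A},\mathcal{B})\in\{0,\ast\}^{n\times(n+r)}$, $n\ge 1$, have $\nu$ $\ast$-entries. A compressed column storage of $\mathcal{X}$ consists of two integer arrays, $i_s$ of length $n+r+1$ and $s$ of length $\nu$,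 such that, for $1\le j\le n+r+1$, $i_s(j)-1$ is the number of $\ast$-entries in the first $j-1$ columns of $\mathcal{X}$, and, for $1\le i\le n$ and $1\le j\le n+r$, $\mathcal{X}_{i,j}=\ast$ if and only if $s(k)=i$ for some $k$ with $i_s(j)\le k<i_s(j+1)$. **Theorem.** Strong structural controllability of a pair of structural matrices can be verified with time complexity $\mathcal{O}(n+r+\nu)$. That is, there are one program for a random access machine and one constant $C$ such that for all $n\geq 1$, $r\ge 0$, every pair $(\mathcal{A},\mathcal{B})\in\{0,\ast\}^{n\times(n+r)}$ with $\nu$ $\ast$-entries, and every compressed column storage $(s,i_s)$ of $(\mathcal{A},\mathcal{B})$, the program, given $n$, $r$, $i_s$ and $s$ in its memory, halts after at most $C\,(n+r+\nu)$ steps with output $1$ if $(\mathcal{A},\mathcal{B})$ is strong structurally controllable and with output $0$ otherwise; the same program serves both $\mathbb{F}=\mathbb{R}$ and $\mathbb{F}=\mathbb{C}$. Here the machine has finitely many registers and an indirectly addressed memory, all holding natural numbers. Each of the following is one step: loading a constant, copying a register, adding or subtracting (with negative results replaced by $0$) two registers, reading or writing the memory cell whose address is in a register, doing nothing, and testing whether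 a register is positive in an if- or while-statement. No number that the program computes exceeds $C\,(n+r+\nu)$. -/

import Mathlib

/-! ## Linear systems and strong structural controllability -/

/-- A structural matrix, i.e. an element of `{0, ∗}^{n × m}`: `true` stands for `∗`, `false` for `0`. -/
abbrev StructMatrix (n m : ℕ) : Type := Matrix (Fin n) (Fin m) Bool

/-- `X` has the non-zero structure of `𝒳`: `X i j ≠ 0` exactly at the `∗`-entries of `𝒳`. -/
def HasNonzeroStructure {𝔽 : Type*} [Zero 𝔽] {n m : ℕ}
    (X : Matrix (Fin n) (Fin m) 𝔽) (𝒳 : StructMatrix n m) : Prop :=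
  ∀ i j, X i j ≠ 0 ↔ 𝒳 i j = true

/-- The input `u` (measurable and essentially bounded on `[0, T]`) steers the system
`x' = A x + B u` from the state `x₀` at time `0` to the state `x₁` at time `T`:
the corresponding (Carathéodory) solution `x` on `[0, T]` starts in `x₀` and ends in `x₁`. -/
def Steers {𝔽 : Type*} [RCLike 𝔽] {n r : ℕ}
    (A : Matrix (Fin n) (Fin n) 𝔽) (B : Matrix (Fin n) (Fin r) 𝔽)
    (x₀ x₁ : Fin n → 𝔽) (T : ℝ) (u : ℝ → Fin r → 𝔽) : Prop :=
  MeasureTheory.MemLp u ⊤ (MeasureTheory.volume.restrict (Set.Icc 0 T)) ∧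
  ∃ x : ℝ → Fin n → 𝔽,
    ContinuousOn x (Set.Icc 0 T) ∧
    (∀ t ∈ Set.Icc 0 T,
      x t = x₀ + ∫ τ in (0 : ℝ)..t, (A.mulVec (x τ) + B.mulVec (u τ))) ∧
    x T = x₁

/-- The system `x' = A x + B u` is controllable: any initial state can be steered to any
terminal state in some time `T > 0` by some input signal. -/
def IsControllable {𝔽 : Type*} [RCLike 𝔽] {n r : ℕ}
    (A : Matrix (Fin n) (Fin n) 𝔽) (B : Matrix (Fin n) (Fin r) 𝔽) : Prop :=
  ∀ x₀ x₁ : Fin n → 𝔽, ∃ T : ℝ, 0 < T ∧ ∃ u : ℝ → Fin r → 𝔽, Steers A B x₀ x₁ T u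

/-- `(𝒜, ℬ)` is strong structurally controllable over `𝔽`: every pair of matrices over `𝔽` with
the non-zero structure of `(𝒜, ℬ)` is controllable. -/
def StrongStructControllable (𝔽 : Type*) [RCLike 𝔽] {n r : ℕ}
    (𝒜 : StructMatrix n n) (ℬ : StructMatrix n r) : Prop :=
  ∀ (A : Matrix (Fin n) (Fin n) 𝔽) (B : Matrix (Fin n) (Fin r) 𝔽),
    HasNonzeroStructure A 𝒜 → HasNonzeroStructure B ℬ → IsControllable A B

/-! ## Sparse representation -/

/-- The `n × (n + r)` structural matrix `(𝒜, ℬ)`. -/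
def pairMatrix {n r : ℕ} (𝒜 : StructMatrix n n) (ℬ : StructMatrix n r) : StructMatrix n (n + r) :=
  fun i => Fin.append (𝒜 i) (ℬ i)

/-- The number of `∗`-entries in the first `j` columns of `𝒳`. -/
def starsBefore {n m : ℕ} (𝒳 : StructMatrix n m) (j : ℕ) : ℕ :=
  (Finset.univ.filter fun p : Fin n × Fin m => (p.2 : ℕ) < j ∧ 𝒳 p.1 p.2 = true).card

/-- The number `ν` of `∗`-entries of `𝒳`. -/
def numStars {n m : ℕ} (𝒳 : StructMatrix n m) : ℕ :=
  (Finset.univ.filter fun p : Fin n × Fin m => 𝒳 p.1 p.2 = true).card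

/-- The integer arrays `colPtr` (of length `m + 1`) and `rowIdx` (of length `ν`) are a compressed
column storage of `𝒳`. Rows, columns and array positions are numbered from `1`, as the array
entries; so the entry in position `k` of an array `a` is `a[k - 1]?`, and the row `i : Fin n` has
number `i + 1`. The order of the row indices inside a column is arbitrary. -/
def IsCCS {n m : ℕ} (𝒳 : StructMatrix n m) (colPtr rowIdx : List ℕ) : Prop :=
  colPtr.length = m + 1 ∧
  rowIdx.length = numStars 𝒳 ∧
  (∀ j, j ≤ m → colPtr[j]? = some (starsBefore 𝒳 j + 1)) ∧
  (∀ (i : Fin n) (j : Fin m), 𝒳 i j = true ↔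
    ∃ k, starsBefore 𝒳 j + 1 ≤ k ∧ k < starsBefore 𝒳 (j + 1) + 1 ∧
      rowIdx[k - 1]? = some ((i : ℕ) + 1))

/-! ## Random access machine

Goto-free programs of a unit-cost random access machine. Addition and (truncated) subtraction are
the only arithmetic operations. -/

namespace RAM

/-- Registers (a program names finitely many of them) and a memory that is addressed indirectly. -/
structure State where
  reg : ℕ → ℕ
  mem : ℕ → ℕ

/-- The state with the value of register `a` replaced by `v`. -/
def State.setReg (σ : State) (a v : ℕ) : State :=
  { σ with reg := Function.update σ.reg a v }

/-- The state with the content of memory cell `a` replaced by `v`. -/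
def State.setMem (σ : State) (a v : ℕ) : State :=
  { σ with mem := Function.update σ.mem a v }

/-- Start state: the input occupies the memory cells `0, 1, …`; everything else is `0`. -/
def State.init (input : List ℕ) : State where
  reg := fun _ => 0
  mem := fun a => input.getD a 0

/-- Programs; `a`, `b`, `d` are names of registers. -/
inductive Prog : Type
  /-- no operation -/
  | skip : Prog
  /-- `d := c` -/
  | const (d c : ℕ) : Prog
  /-- `d := a` -/
  | copy (d a : ℕ) : Prog
  /-- `d := a + b` -/
  | add (d a b : ℕ) : Prog
  /-- `d := max (a - b) 0` -/
  | sub (d a b : ℕ) : Prog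
  /-- `d := mem[a]` -/
  | load (d a : ℕ) : Prog
  /-- `mem[a] := b` -/
  | store (a b : ℕ) : Prog
  /-- first `p`, then `q` -/
  | seq (p q : Prog) : Prog
  /-- if `a > 0` then `p` else `q` -/
  | cond (a : ℕ) (p q : Prog) : Prog
  /-- while `a > 0` do `p` -/
  | loop (a : ℕ) (p : Prog) : Prog

/-- `Exec W p σ t σ'`: on a machine whose words hold the numbers `0, …, W`, the program `p`, started
in the state `σ`, halts after exactly `t` steps in the state `σ'`. Each operation and each test is
one step. An operation whose result does not fit into a word cannot be executed. -/
inductive Exec (W : ℕ) : Prog → State → ℕ → State → Prop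
  | skip (σ : State) : Exec W Prog.skip σ 1 σ
  | const (d c : ℕ) (σ : State) : c ≤ W →
      Exec W (Prog.const d c) σ 1 (σ.setReg d c)
  | copy (d a : ℕ) (σ : State) :
      Exec W (Prog.copy d a) σ 1 (σ.setReg d (σ.reg a))
  | add (d a b : ℕ) (σ : State) : σ.reg a + σ.reg b ≤ W →
      Exec W (Prog.add d a b) σ 1 (σ.setReg d (σ.reg a + σ.reg b))
  | sub (d a b : ℕ) (σ : State) :
      Exec W (Prog.sub d a b) σ 1 (σ.setReg d (σ.reg a - σ.reg b))
  | load (d a : ℕ) (σ : State) : σ.mem (σ.reg a) ≤ W →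
      Exec W (Prog.load d a) σ 1 (σ.setReg d (σ.mem (σ.reg a)))
  | store (a b : ℕ) (σ : State) :
      Exec W (Prog.store a b) σ 1 (σ.setMem (σ.reg a) (σ.reg b))
  | seq (p q : Prog) (σ σ' σ'' : State) (t t' : ℕ) : Exec W p σ t σ' → Exec W q σ' t' σ'' →
      Exec W (Prog.seq p q) σ (t + t') σ''
  | cond_pos (a : ℕ) (p q : Prog) (σ σ' : State) (t : ℕ) : 0 < σ.reg a → Exec W p σ t σ' →
      Exec W (Prog.cond a p q) σ (t + 1) σ'
  | cond_zero (a : ℕ) (p q : Prog) (σ σ' : State) (t : ℕ) : σ.reg a = 0 → Exec W q σ t σ' →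
      Exec W (Prog.cond a p q) σ (t + 1) σ'
  | loop_zero (a : ℕ) (p : Prog) (σ : State) : σ.reg a = 0 →
      Exec W (Prog.loop a p) σ 1 σ
  | loop_pos (a : ℕ) (p : Prog) (σ σ' σ'' : State) (t t' : ℕ) : 0 < σ.reg a →
      Exec W p σ t σ' → Exec W (Prog.loop a p) σ' t' σ'' →
      Exec W (Prog.loop a p) σ (t + t' + 1) σ''

end RAM

/-!
By the Hautus test over an algebraically closed extension of `𝔽`, the pair `(A, B)` fails to be
controllable only if `A` has a left eigenvector `v ≠ 0` that annihilates `B`, and such a `v` over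
`𝔽` also prevents controllability. On the support `V` of `v`, a column of `(𝒜, ℬ)` with exactly one
`∗` in the rows `V` makes these equations unsolvable for the eigenvalue `0`; for a nonzero
eigenvalue, the `∗`-entries have to be counted together with one more entry at each diagonal
position of `𝒜`. If no column has count one, then the nonzero entries can be chosen such that the
indicator vector of `V` is an eigenvector for `0` or `1`. So strong structural controllability means
that each of two bipartite multigraphs, that of `(𝒜, ℬ)` and the one with the additional diagonal
edges, can be *peeled*: every nonempty set of rows has a column with exactly one edge.

This is decided greedily: as long as some column has a single edge left, remove the row of that
edge together with all its edges. The rows that remain in the end form the largest set without such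
a column. Both graphs are peeled at once, as one graph with `2n` rows. For linear time, the edges of
each row are linked, and each column keeps the number of its edges and the sum of their row indices
modulo `2n`; when the number is one, the sum is the row. Each edge is removed at most once and
pushes its column on the stack of columns to be inspected, so the number of steps is proportional to
the number of edges.
-/

open scoped Matrix

section Control

open Set MeasureTheory

theorem eq_zero_of_eq_intervalIntegral_smul {𝕜 E : Type*} [NormedField 𝕜] [NormedAddCommGroup E]
    [NormedSpace ℝ E] [NormedSpace 𝕜 E] [CompleteSpace E] {y : ℝ → E} {c : 𝕜} {T : ℝ}
    (hy : ContinuousOn y (Icc 0 T)) (h : ∀ t ∈ Icc 0 T, y t = ∫ τ in (0 : ℝ)..t, c • y τ) :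
    ∀ t ∈ Icc 0 T, y t = 0 := by
  have hcy : ContinuousOn (fun τ => c • y τ) (Icc 0 T) := hy.const_smul c
  have hderiv : ∀ t ∈ Ico 0 T,
      HasDerivWithinAt (fun t => ∫ τ in (0 : ℝ)..t, c • y τ) (c • y t) (Ici t) t := by
    intro t ht
    have hmem : Icc t T ∈ nhdsWithin t (Ioi t) :=
      Filter.mem_of_superset (Ioo_mem_nhdsGT ht.2) Ioo_subset_Icc_self
    have hcont : ContinuousOn (fun τ => c • y τ) (Icc t T) := hcy.mono (Icc_subset_Icc_left ht.1)
    refine intervalIntegral.integral_hasDerivWithinAt_right (t := Ioi t) ?_ ?_ ?_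
    · exact (hcy.mono (Icc_subset_Icc_right ht.2.le)).intervalIntegrable_of_Icc ht.1
    · exact ⟨Icc t T, hmem, hcont.aestronglyMeasurable measurableSet_Icc⟩
    · exact (hcont t (left_mem_Icc.2 ht.2.le)).mono_of_mem_nhdsWithin hmem
  intro t ht
  rw [h t ht]
  exact eq_zero_of_abs_deriv_le_mul_abs_self_of_eq_zero_right (K := ‖c‖)
    (hy.congr fun t ht => (h t ht).symm) hderiv intervalIntegral.integral_same
    (fun t ht => by rw [norm_smul, ← h t (Ico_subset_Icc_self ht)]) t ht

section Controllability

variable {𝔽 : Type*} [RCLike 𝔽] {n r : ℕ} {A : Matrix (Fin n) (Fin n) 𝔽}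
  {B : Matrix (Fin n) (Fin r) 𝔽}

theorem Steers.dotProduct_eq_zero {v x₁ : Fin n → 𝔽} {μ : 𝔽} {T : ℝ} {u : ℝ → Fin r → 𝔽}
    (h : Steers A B 0 x₁ T u) (hT : 0 ≤ T) (hA : v ᵥ* A = μ • v) (hB : v ᵥ* B = 0) :
    v ⬝ᵥ x₁ = 0 := by
  obtain ⟨hu, x, hx, hsol, rfl⟩ := h
  let L : (Fin n → 𝔽) →L[𝔽] 𝔽 := (dotProductBilin 𝔽 𝔽 v).toContinuousLinearMap
  have hint : IntegrableOn (fun τ => A *ᵥ x τ + B *ᵥ u τ) (Icc 0 T) :=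
    (A.mulVecLin.toContinuousLinearMap.integrable_comp hx.integrableOn_Icc).add
      (B.mulVecLin.toContinuousLinearMap.integrable_comp (hu.integrable le_top))
  refine eq_zero_of_eq_intervalIntegral_smul (y := fun t => L (x t)) (c := μ)
    (L.continuous.comp_continuousOn hx) (fun t ht => ?_) T (right_mem_Icc.2 hT)
  have hint_t : IntervalIntegrable (fun τ => A *ᵥ x τ + B *ᵥ u τ) volume 0 t :=
    (intervalIntegrable_iff_integrableOn_Icc_of_le ht.1).2
      (hint.mono_set (Icc_subset_Icc_right ht.2))
  calc L (x t) = ∫ τ in (0 : ℝ)..t, v ⬝ᵥ (A *ᵥ x τ + B *ᵥ u τ) := by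
        rw [hsol t ht, zero_add, ← L.intervalIntegral_comp_comm hint_t]
        rfl
    _ = ∫ τ in (0 : ℝ)..t, μ • L (x τ) := by
        simp only [dotProduct_add, Matrix.dotProduct_mulVec, hA, hB, zero_dotProduct, add_zero,
          smul_dotProduct]
        rfl

theorem not_isControllable_of_vecMul_eq_smul {v : Fin n → 𝔽} {μ : 𝔽} (hv : v ≠ 0)
    (hA : v ᵥ* A = μ • v) (hB : v ᵥ* B = 0) : ¬ IsControllable A B := by
  intro hctrl
  refine hv (dotProduct_eq_zero v fun w => ?_)
  obtain ⟨T, hT, u, hsteers⟩ := hctrl 0 w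
  exact hsteers.dotProduct_eq_zero hT.le hA hB

end Controllability

section UncontrollableSubspace

variable {ι κ K L : Type*} [Fintype ι] [DecidableEq ι]

/-- The left uncontrollable subspace of `(A, B)`, i.e. the row vectors that annihilate the Kalman
matrix `(B, A B, A² B, …)`; the Kalman rank condition says that it is trivial. -/
def uncontrollableSubspace [CommRing K] (A : Matrix ι ι K) (B : Matrix ι κ K) :
    Submodule K (ι → K) where
  carrier := {w | ∀ k : ℕ, w ᵥ* A ^ k ᵥ* B = 0}
  add_mem' ha hb k := by rw [Matrix.add_vecMul, Matrix.add_vecMul, ha k, hb k, add_zero]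
  zero_mem' k := by rw [Matrix.zero_vecMul, Matrix.zero_vecMul]
  smul_mem' c w hw k := by rw [Matrix.smul_vecMul, Matrix.smul_vecMul, hw k, smul_zero]

section CommRing

variable [CommRing K] {A : Matrix ι ι K} {B : Matrix ι κ K} {w : ι → K}

theorem vecMul_eq_zero_of_mem_uncontrollableSubspace (hw : w ∈ uncontrollableSubspace A B) :
    w ᵥ* B = 0 := by
  simpa only [pow_zero, Matrix.vecMul_one] using hw 0

theorem vecMul_mem_uncontrollableSubspace (hw : w ∈ uncontrollableSubspace A B) :
    w ᵥ* A ∈ uncontrollableSubspace A B := fun k => by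
  rw [Matrix.vecMul_vecMul w, ← pow_succ']
  exact hw (k + 1)

theorem map_mem_uncontrollableSubspace [CommRing L] (f : K →+* L)
    (hw : w ∈ uncontrollableSubspace A B) :
    f ∘ w ∈ uncontrollableSubspace (A.map f) (B.map f) := fun k => by
  ext l
  have hpow : f ∘ w ᵥ* A.map f ^ k = f ∘ (w ᵥ* A ^ k) := by
    rw [← Matrix.map_pow]
    exact (funext (f.map_vecMul (A ^ k) w)).symm
  rw [hpow, ← f.map_vecMul, hw k, Pi.zero_apply, map_zero, Pi.zero_apply]

end CommRing

theorem exists_left_eigenvector_of_uncontrollableSubspace_ne_bot [Field K] [IsAlgClosed K]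
    {A : Matrix ι ι K} {B : Matrix ι κ K} (h : uncontrollableSubspace A B ≠ ⊥) :
    ∃ (v : ι → K) (μ : K), v ≠ 0 ∧ v ᵥ* A = μ • v ∧ v ᵥ* B = 0 := by
  have hinv : ∀ w ∈ uncontrollableSubspace A B, A.vecMulLinear w ∈ uncontrollableSubspace A B :=
    fun _ => vecMul_mem_uncontrollableSubspace
  have : Nontrivial (uncontrollableSubspace A B) := Submodule.nontrivial_iff_ne_bot.2 h
  obtain ⟨μ, hμ⟩ := Module.End.exists_eigenvalue (A.vecMulLinear.restrict hinv)
  obtain ⟨w, hw⟩ := hμ.exists_hasEigenvector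
  exact ⟨w, μ, fun h0 => hw.2 (Subtype.ext h0), congrArg Subtype.val hw.apply_eq_smul,
    vecMul_eq_zero_of_mem_uncontrollableSubspace w.2⟩

end UncontrollableSubspace

section VariationOfConstants

open scoped Matrix.Norms.Operator
open NormedSpace (exp)

variable {𝔽 ι κ : Type*} [RCLike 𝔽] [Fintype κ]

theorem hasDerivAt_matrix_mulVec [Finite ι] {M : ℝ → Matrix ι κ 𝔽} {M' : Matrix ι κ 𝔽}
    {w : ℝ → κ → 𝔽} {w' : κ → 𝔽} {t : ℝ} (hM : HasDerivAt M M' t) (hw : HasDerivAt w w' t) :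
    HasDerivAt (fun t => M t *ᵥ w t) (M' *ᵥ w t + M t *ᵥ w') t := by
  have := Fintype.ofFinite ι
  refine hasDerivAt_pi.2 fun i => ?_
  have hentry : ∀ j, HasDerivAt (fun t => M t i j) (M' i j) t := fun j =>
    (Matrix.entryLinearMap ℝ 𝔽 i j).toContinuousLinearMap.hasFDerivAt.comp_hasDerivAt t hM
  simpa only [Matrix.mulVec, dotProduct, Pi.add_apply, Finset.sum_add_distrib] using
    HasDerivAt.fun_sum (u := Finset.univ) fun j _ => (hentry j).fun_mul (hasDerivAt_pi.1 hw j)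

variable [Fintype ι] [DecidableEq ι]

theorem matrix_exp_mul_exp_neg (M : Matrix ι ι 𝔽) : exp M * exp (-M) = 1 := by
  rw [← Matrix.exp_add_of_commute _ _ (Commute.refl M).neg_right, add_neg_cancel,
    NormedSpace.exp_zero]

theorem hasDerivAt_matrix_exp_smul (A : Matrix ι ι 𝔽) (t : ℝ) :
    HasDerivAt (fun t : ℝ => exp (t • A)) (A * exp (t • A)) t :=
  hasDerivAt_exp_smul_const' A t

theorem continuous_matrix_exp_smul (A : Matrix ι ι 𝔽) : Continuous fun t : ℝ => exp (t • A) :=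
  continuous_iff_continuousAt.2 fun t => (hasDerivAt_matrix_exp_smul A t).continuousAt

variable (A : Matrix ι ι 𝔽) (B : Matrix ι κ 𝔽)

theorem continuous_exp_neg_smul_mulVec (u : C(ℝ, κ → 𝔽)) :
    Continuous fun τ : ℝ => exp (-(τ • A)) *ᵥ (B *ᵥ u τ) := by
  simp only [← smul_neg]
  exact (continuous_matrix_exp_smul (-A)).matrix_mulVec
    (continuous_const.matrix_mulVec u.continuous)

/-- The map that sends an input `u` to `∫₀¹ e^(-τ A) B u(τ) dτ`. By variation of constants, `u`
steers `x₀` to `x₁` in time `1` if and only if this is `e^(-A) x₁ - x₀`. -/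
noncomputable def reachabilityMap : C(ℝ, κ → 𝔽) →ₗ[𝔽] (ι → 𝔽) where
  toFun u := ∫ τ in (0 : ℝ)..1, exp (-(τ • A)) *ᵥ (B *ᵥ u τ)
  map_add' u w := by
    rw [← intervalIntegral.integral_add
      ((continuous_exp_neg_smul_mulVec A B u).intervalIntegrable _ _)
      ((continuous_exp_neg_smul_mulVec A B w).intervalIntegrable _ _)]
    simp only [ContinuousMap.add_apply, Matrix.mulVec_add]
  map_smul' c u := by
    simp only [ContinuousMap.smul_apply, Matrix.mulVec_smul, intervalIntegral.integral_smul,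
      RingHom.id_apply]

variable {A B}

theorem dotProduct_reachabilityMap (v : ι → 𝔽) (u : C(ℝ, κ → 𝔽)) :
    v ⬝ᵥ reachabilityMap A B u =
      ∫ τ in (0 : ℝ)..1, (v ᵥ* exp (-(τ • A)) ᵥ* B) ⬝ᵥ u τ := by
  simp only [← Matrix.dotProduct_mulVec]
  exact ((dotProductBilin 𝔽 𝔽 v).toContinuousLinearMap.intervalIntegral_comp_comm
    ((continuous_exp_neg_smul_mulVec A B u).intervalIntegrable 0 1)).symm

theorem eqOn_zero_of_intervalIntegral_dotProduct_star_eq_zero {g : ℝ → κ → 𝔽} (hg : Continuous g)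
    {a b : ℝ} (hab : a < b) (h : ∫ τ in a..b, g τ ⬝ᵥ star (g τ) = 0) : EqOn g 0 (Icc a b) := by
  intro s hs
  have hnorm : ∀ τ, g τ ⬝ᵥ star (g τ) = ((∑ l, ‖g τ l‖ ^ 2 : ℝ) : 𝔽) := fun τ => by
    simp only [dotProduct, Pi.star_apply, RCLike.star_def, RCLike.mul_conj, RCLike.ofReal_sum,
      RCLike.ofReal_pow]
  have hcont : Continuous fun τ => ∑ l, ‖g τ l‖ ^ 2 :=
    continuous_finsetSum _ fun l _ => ((continuous_apply l).comp hg).norm.pow 2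
  have hreal : ∫ τ in a..b, ∑ l, ‖g τ l‖ ^ 2 = 0 := by
    rw [intervalIntegral.integral_congr fun τ _ => hnorm τ, RCLike.intervalIntegral_ofReal] at h
    exact RCLike.ofReal_eq_zero.1 h
  by_contra hne
  obtain ⟨l, hl⟩ := Function.ne_iff.1 hne
  refine hreal.not_gt (intervalIntegral.integral_pos hab hcont.continuousOn
    (fun τ _ => by positivity) ⟨s, hs, ?_⟩)
  exact Finset.sum_pos' (fun l _ => by positivity)
    ⟨l, Finset.mem_univ l, pow_pos (norm_pos_iff.2 hl) 2⟩

theorem vecMul_exp_eq_zero_of_forall_dotProduct_reachabilityMap {v : ι → 𝔽}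
    (h : ∀ u, v ⬝ᵥ reachabilityMap A B u = 0) :
    ∀ s ∈ Icc (0 : ℝ) 1, v ᵥ* exp (-(s • A)) ᵥ* B = 0 := by
  have hcont : Continuous fun s : ℝ => v ᵥ* exp (-(s • A)) ᵥ* B := by
    simp only [← smul_neg]
    exact (continuous_const.matrix_vecMul (continuous_matrix_exp_smul (-A))).matrix_vecMul
      continuous_const
  refine eqOn_zero_of_intervalIntegral_dotProduct_star_eq_zero hcont zero_lt_one ?_
  rw [← h ⟨_, hcont.star⟩, dotProduct_reachabilityMap]
  rfl

theorem vecMul_pow_exp_eq_zero {ρ : Type*} [Finite ρ] {B : Matrix ι ρ 𝔽} {v : ι → 𝔽}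
    (h : ∀ s ∈ Icc (0 : ℝ) 1, v ᵥ* exp (-(s • A)) ᵥ* B = 0) (k : ℕ) :
    ∀ s ∈ Icc (0 : ℝ) 1, v ᵥ* A ^ k ᵥ* exp (-(s • A)) ᵥ* B = 0 := by
  have := Fintype.ofFinite ρ
  induction k with
  | zero => simpa only [pow_zero, Matrix.vecMul_one] using h
  | succ k ih =>
    intro s hs
    let Λ : Matrix ι ι 𝔽 →L[ℝ] ρ → 𝔽 := LinearMap.toContinuousLinearMap
      { toFun := fun M => v ᵥ* A ^ k ᵥ* M ᵥ* B
        map_add' := fun M N => by rw [Matrix.vecMul_add, Matrix.add_vecMul]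
        map_smul' := fun c M => by rw [Matrix.vecMul_smul, Matrix.smul_vecMul, RingHom.id_apply] }
    have hexp : HasDerivAt (fun s : ℝ => exp (-(s • A))) (-A * exp (-(s • A))) s := by
      simpa only [smul_neg] using hasDerivAt_matrix_exp_smul (-A) s
    have hΛ : HasDerivWithinAt (fun s : ℝ => Λ (exp (-(s • A)))) (Λ (-A * exp (-(s • A))))
        (Icc 0 1) s :=
      (Λ.hasFDerivAt.comp_hasDerivAt s hexp).hasDerivWithinAt
    have hzero : Λ (-A * exp (-(s • A))) = 0 :=
      (uniqueDiffOn_Icc_zero_one s hs).eq_deriv _ hΛ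
        ((hasDerivWithinAt_const s _ 0).congr_of_mem ih hs)
    rw [neg_mul, map_neg, neg_eq_zero] at hzero
    rwa [pow_succ, ← Matrix.vecMul_vecMul v, Matrix.vecMul_vecMul _ A]

theorem range_reachabilityMap_eq_top (h : uncontrollableSubspace A B = ⊥) :
    LinearMap.range (reachabilityMap A B) = ⊤ := by
  by_contra hne
  obtain ⟨φ, hφ, hle⟩ := Submodule.exists_le_ker_of_lt_top _ (lt_top_iff_ne_top.2 hne)
  obtain ⟨v, rfl⟩ := (dotProductEquiv 𝔽 ι).surjective φ
  have hzero := vecMul_exp_eq_zero_of_forall_dotProduct_reachabilityMap (v := v)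
    fun u => hle (LinearMap.mem_range_self _ u)
  have hv : v ∈ uncontrollableSubspace A B := fun k => by
    simpa only [zero_smul, neg_zero, NormedSpace.exp_zero, Matrix.vecMul_one] using
      vecMul_pow_exp_eq_zero hzero k 0 (left_mem_Icc.2 zero_le_one)
  rw [h, Submodule.mem_bot] at hv
  exact hφ (by rw [hv, map_zero])

theorem steers_of_reachabilityMap_eq {n r : ℕ} {A : Matrix (Fin n) (Fin n) 𝔽}
    {B : Matrix (Fin n) (Fin r) 𝔽} {x₀ x₁ : Fin n → 𝔽} {u : C(ℝ, Fin r → 𝔽)}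
    (hu : reachabilityMap A B u = exp (-A) *ᵥ x₁ - x₀) : Steers A B x₀ x₁ 1 u := by
  let w : ℝ → Fin n → 𝔽 := fun t => x₀ + ∫ τ in (0 : ℝ)..t, exp (-(τ • A)) *ᵥ (B *ᵥ u τ)
  have hw : ∀ t : ℝ, HasDerivAt w (exp (-(t • A)) *ᵥ (B *ᵥ u t)) t := fun t =>
    ((continuous_exp_neg_smul_mulVec A B u).integral_hasStrictDerivAt 0 t).hasDerivAt.const_add x₀
  have hw0 : w 0 = x₀ := by simp only [w, intervalIntegral.integral_same, add_zero]
  have hw1 : w 1 = exp (-A) *ᵥ x₁ := (congrArg (x₀ + ·) hu).trans (add_sub_cancel _ _)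
  have hx : ∀ t : ℝ, HasDerivAt (fun t : ℝ => exp (t • A) *ᵥ w t)
      (A *ᵥ (exp (t • A) *ᵥ w t) + B *ᵥ u t) t := fun t => by
    have := hasDerivAt_matrix_mulVec (hasDerivAt_matrix_exp_smul A t) (hw t)
    rwa [Matrix.mulVec_mulVec, matrix_exp_mul_exp_neg, Matrix.one_mulVec,
      ← Matrix.mulVec_mulVec] at this
  have hxc : Continuous fun t : ℝ => exp (t • A) *ᵥ w t :=
    continuous_iff_continuousAt.2 fun t => (hx t).continuousAt
  have hrhs : Continuous fun t : ℝ => A *ᵥ (exp (t • A) *ᵥ w t) + B *ᵥ u t :=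
    (continuous_const.matrix_mulVec hxc).add (continuous_const.matrix_mulVec u.continuous)
  obtain ⟨C, hC⟩ := isCompact_Icc.exists_bound_of_continuousOn (s := Icc (0 : ℝ) 1)
    u.continuous.continuousOn
  refine ⟨memLp_top_of_bound u.continuous.aestronglyMeasurable C
    ((ae_restrict_iff' measurableSet_Icc).2 (.of_forall hC)),
    fun t => exp (t • A) *ᵥ w t, hxc.continuousOn, fun t _ => ?_, ?_⟩
  · rw [intervalIntegral.integral_eq_sub_of_hasDerivAt (fun τ _ => hx τ)
      (hrhs.intervalIntegrable _ _), hw0, zero_smul, NormedSpace.exp_zero, Matrix.one_mulVec,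
      add_sub_cancel]
  · simp only [one_smul, hw1, Matrix.mulVec_mulVec, matrix_exp_mul_exp_neg, Matrix.one_mulVec]

theorem isControllable_of_uncontrollableSubspace_eq_bot {n r : ℕ} {A : Matrix (Fin n) (Fin n) 𝔽}
    {B : Matrix (Fin n) (Fin r) 𝔽} (h : uncontrollableSubspace A B = ⊥) : IsControllable A B := by
  intro x₀ x₁
  obtain ⟨u, hu⟩ := LinearMap.range_eq_top.1 (range_reachabilityMap_eq_top h)
    (exp (-A) *ᵥ x₁ - x₀)
  exact ⟨1, one_pos, u, steers_of_reachabilityMap_eq hu⟩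

end VariationOfConstants

theorem exists_left_eigenvector_of_not_isControllable {𝔽 K : Type*} [RCLike 𝔽] [Field K]
    [IsAlgClosed K] (f : 𝔽 →+* K) {n r : ℕ} {A : Matrix (Fin n) (Fin n) 𝔽}
    {B : Matrix (Fin n) (Fin r) 𝔽} (h : ¬ IsControllable A B) :
    ∃ (v : Fin n → K) (μ : K), v ≠ 0 ∧ v ᵥ* A.map f = μ • v ∧ v ᵥ* B.map f = 0 := by
  have hne : uncontrollableSubspace A B ≠ ⊥ :=
    fun hbot => h (isControllable_of_uncontrollableSubspace_eq_bot hbot)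
  obtain ⟨w, hw, hw0⟩ := Submodule.exists_mem_ne_zero_of_ne_bot hne
  refine exists_left_eigenvector_of_uncontrollableSubspace_ne_bot fun hbot => hw0 ?_
  have hfw := map_mem_uncontrollableSubspace f hw
  rw [hbot, Submodule.mem_bot] at hfw
  exact funext fun i => f.injective ((congrFun hfw i).trans (map_zero f).symm)

end Control

section Peelable

/-- A matrix of weights is peelable if every nonempty set of rows has a column in which the weights
of these rows add up to `1`. For a `0`-`1` matrix this says that every nonempty set of rows can be
emptied by repeatedly removing a row that is the only one with a `1` in some column. -/
def Peelable {ι κ : Type*} (w : Matrix ι κ ℕ) : Prop :=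
  ∀ V : Finset ι, V.Nonempty → ∃ j, ∑ i ∈ V, w i j = 1

variable {ι ι' κ κ' : Type*}

theorem Peelable.submatrix {w : Matrix ι κ ℕ} (h : Peelable w) (e : ι' ≃ ι) (f : κ' ≃ κ) :
    Peelable (w.submatrix e f) := by
  intro V hV
  obtain ⟨j, hj⟩ := h (V.map e.toEmbedding) (hV.map)
  exact ⟨f.symm j, by simpa only [Finset.sum_map, Matrix.submatrix_apply, f.apply_symm_apply,
    Equiv.coe_toEmbedding] using hj⟩

theorem peelable_submatrix_equiv {w : Matrix ι κ ℕ} (e : ι' ≃ ι) (f : κ' ≃ κ) :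
    Peelable (w.submatrix e f) ↔ Peelable w := by
  refine ⟨fun h => ?_, fun h => h.submatrix e f⟩
  simpa only [Matrix.submatrix_submatrix, Equiv.self_comp_symm, Matrix.submatrix_id_id] using
    h.submatrix e.symm f.symm

theorem peelable_fromBlocks_zero {X : Matrix ι κ ℕ} {Y : Matrix ι' κ' ℕ} :
    Peelable (Matrix.fromBlocks X 0 0 Y) ↔ Peelable X ∧ Peelable Y := by
  have hleft : ∀ (V : Finset (ι ⊕ ι')) (j : κ),
      ∑ i ∈ V, Matrix.fromBlocks X 0 0 Y i (.inl j) = ∑ i ∈ V.toLeft, X i j := fun V j => by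
    simp [Finset.sum_sum_eq_sum_toLeft_add_sum_toRight]
  have hright : ∀ (V : Finset (ι ⊕ ι')) (j : κ'),
      ∑ i ∈ V, Matrix.fromBlocks X 0 0 Y i (.inr j) = ∑ i ∈ V.toRight, Y i j := fun V j => by
    simp [Finset.sum_sum_eq_sum_toLeft_add_sum_toRight]
  refine ⟨fun h => ⟨fun V hV => ?_, fun V hV => ?_⟩, fun ⟨hX, hY⟩ V hV => ?_⟩
  · obtain ⟨j | j, hj⟩ := h (V.map .inl) hV.map
    · exact ⟨j, (Finset.sum_map V _ _).symm.trans hj⟩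
    · simp at hj
  · obtain ⟨j | j, hj⟩ := h (V.map .inr) hV.map
    · simp at hj
    · exact ⟨j, (Finset.sum_map V _ _).symm.trans hj⟩
  · rcases V.toLeft.eq_empty_or_nonempty with hempty | hne
    · have hne : V.toRight.Nonempty := by
        rw [← V.toLeft_disjSum_toRight, hempty] at hV
        simpa using hV
      obtain ⟨j, hj⟩ := hY _ hne
      exact ⟨.inr j, (hright V j).trans hj⟩
    · obtain ⟨j, hj⟩ := hX _ hne
      exact ⟨.inl j, (hleft V j).trans hj⟩

/-- The weights by which strong structural controllability is decided: `∗` counts `1`, and every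
diagonal entry counts `δ` more. The choices `δ = 0` and `δ = 1` correspond to left eigenvectors for
the eigenvalue `0` and for nonzero eigenvalues. -/
def peelWeight {n m : ℕ} (δ : ℕ) (𝒳 : StructMatrix n m) : Matrix (Fin n) (Fin m) ℕ :=
  fun i j => (if 𝒳 i j = true then 1 else 0) + if (i : ℕ) = j then δ else 0

variable {n r : ℕ} {𝒜 : StructMatrix n n} {ℬ : StructMatrix n r}

theorem sum_peelWeight_castAdd (δ : ℕ) (V : Finset (Fin n)) (j : Fin n) :
    ∑ i ∈ V, peelWeight δ (pairMatrix 𝒜 ℬ) i (Fin.castAdd r j) =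
      (V.filter fun i => 𝒜 i j = true).card + if j ∈ V then δ else 0 := by
  simp [peelWeight, pairMatrix, Finset.sum_add_distrib, Fin.val_inj]

theorem sum_peelWeight_natAdd (δ : ℕ) (V : Finset (Fin n)) (j : Fin r) :
    ∑ i ∈ V, peelWeight δ (pairMatrix 𝒜 ℬ) i (Fin.natAdd n j) =
      (V.filter fun i => ℬ i j = true).card := by
  have hne : ∀ i : Fin n, (i : ℕ) ≠ n + j := fun i => by omega
  simp [peelWeight, pairMatrix, hne]

end Peelable

section Necessity

variable {ι K : Type*} [Field K] [CharZero K]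

theorem exists_ne_zero_sum_eq_one {S : Finset ι} (hS : S.Nonempty) :
    ∃ c : ι → K, (∀ i, c i ≠ 0) ∧ ∑ i ∈ S, c i = 1 := by
  have hcard : (S.card : K) ≠ 0 := Nat.cast_ne_zero.2 hS.card_pos.ne'
  exact ⟨fun _ => (S.card : K)⁻¹, fun _ => inv_ne_zero hcard, by
    rw [Finset.sum_const, nsmul_eq_mul, mul_inv_cancel₀ hcard]⟩

theorem exists_ne_zero_sum_eq_zero {S : Finset ι} (hS : S.card ≠ 1) :
    ∃ c : ι → K, (∀ i, c i ≠ 0) ∧ ∑ i ∈ S, c i = 0 := by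
  classical
  obtain rfl | ⟨i₀, hi₀⟩ := S.eq_empty_or_nonempty
  · exact ⟨fun _ => 1, fun _ => one_ne_zero, Finset.sum_empty⟩
  have hrest : ((S.erase i₀).card : K) ≠ 0 := by
    rw [Finset.card_erase_of_mem hi₀]
    exact Nat.cast_ne_zero.2 (by have := Finset.card_pos.2 ⟨i₀, hi₀⟩; omega)
  refine ⟨Function.update 1 i₀ (-((S.erase i₀).card : K)), fun i => ?_, ?_⟩
  · obtain rfl | hi := eq_or_ne i i₀
    · simpa using hrest
    · simp [hi]
  · simp [Finset.sum_update_of_mem hi₀, Finset.sdiff_singleton_eq_erase]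

theorem exists_hasNonzeroStructure_sum_eq {n m : ℕ} (𝒳 : StructMatrix n m) (V : Finset (Fin n))
    (d : Fin m → ℕ) (hd : ∀ j, d j ≤ 1)
    (h : ∀ j, (V.filter fun i => 𝒳 i j = true).card + d j ≠ 1) :
    ∃ X : Matrix (Fin n) (Fin m) K, HasNonzeroStructure X 𝒳 ∧ ∀ j, ∑ i ∈ V, X i j = d j := by
  have hcolumn : ∀ j, ∃ c : Fin n → K, (∀ i, c i ≠ 0) ∧
      ∑ i ∈ V.filter (fun i => 𝒳 i j = true), c i = d j := by
    intro j
    obtain hj | hj : d j = 0 ∨ d j = 1 := by have := hd j; omega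
    · rw [hj, Nat.cast_zero]
      exact exists_ne_zero_sum_eq_zero (by simpa only [hj, add_zero] using h j)
    · rw [hj, Nat.cast_one]
      refine exists_ne_zero_sum_eq_one (Finset.card_ne_zero.1 fun h0 => h j ?_)
      rw [h0, hj]
  choose c hc hsum using hcolumn
  refine ⟨fun i j => if 𝒳 i j = true then c j i else 0, fun i j => ?_, fun j => ?_⟩
  · by_cases hij : 𝒳 i j = true <;> simp [hij, hc]
  · rw [← hsum j, Finset.sum_filter]

end Necessity

section Sufficiency

variable {n m : ℕ} {𝒳 : StructMatrix n m} {K : Type*} [Field K]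

theorem HasNonzeroStructure.map {L : Type*} [Field L] {X : Matrix (Fin n) (Fin m) K}
    (h : HasNonzeroStructure X 𝒳) (f : K →+* L) : HasNonzeroStructure (X.map f) 𝒳 := fun i j => by
  rw [Matrix.map_apply, map_ne_zero, h i j]

variable [DecidableEq K] {X : Matrix (Fin n) (Fin m) K} {v : Fin n → K} {j : Fin m}

theorem HasNonzeroStructure.vecMul_apply_eq_sum (h : HasNonzeroStructure X 𝒳) :
    (v ᵥ* X) j =
      ∑ i ∈ (Finset.univ.filter fun i => v i ≠ 0).filter (fun i => 𝒳 i j = true), v i * X i j := by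
  refine (Finset.sum_subset (Finset.subset_univ _) fun (i : Fin n) _ hi => ?_).symm
  rw [Finset.filter_filter, Finset.mem_filter_univ, ← h i j, ← mul_ne_zero_iff] at hi
  exact not_not.1 hi

theorem HasNonzeroStructure.vecMul_apply_ne_zero (h : HasNonzeroStructure X 𝒳)
    (hone : ((Finset.univ.filter fun i => v i ≠ 0).filter fun i => 𝒳 i j = true).card = 1) :
    (v ᵥ* X) j ≠ 0 := by
  obtain ⟨i, hi⟩ := Finset.card_eq_one.1 hone
  have hmem := hi ▸ Finset.mem_singleton_self i
  rw [Finset.filter_filter, Finset.mem_filter_univ, ← h i j] at hmem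
  rw [h.vecMul_apply_eq_sum, hi, Finset.sum_singleton]
  exact mul_ne_zero hmem.1 hmem.2

theorem HasNonzeroStructure.vecMul_apply_eq_zero (h : HasNonzeroStructure X 𝒳)
    (hzero : ((Finset.univ.filter fun i => v i ≠ 0).filter fun i => 𝒳 i j = true).card = 0) :
    (v ᵥ* X) j = 0 := by
  rw [h.vecMul_apply_eq_sum, Finset.card_eq_zero.1 hzero, Finset.sum_empty]

end Sufficiency

section StrongStructControllable

variable {n r : ℕ} {𝒜 : StructMatrix n n} {ℬ : StructMatrix n r}

theorem vecMul_ne_zero_of_peelable {K : Type*} [Field K] [DecidableEq K]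
    {A : Matrix (Fin n) (Fin n) K} {B : Matrix (Fin n) (Fin r) K}
    (hA : HasNonzeroStructure A 𝒜) (hB : HasNonzeroStructure B ℬ)
    {v : Fin n → K} {μ : K} (hv : v ≠ 0) (hvA : v ᵥ* A = μ • v)
    (h : Peelable (peelWeight (if μ = 0 then 0 else 1) (pairMatrix 𝒜 ℬ))) : v ᵥ* B ≠ 0 := by
  intro hvB
  obtain ⟨i₀, hi₀⟩ := Function.ne_iff.1 hv
  obtain ⟨j, hj⟩ := h (Finset.univ.filter fun i => v i ≠ 0) ⟨i₀, by simpa using hi₀⟩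
  induction j using Fin.addCases with
  | right j =>
    rw [sum_peelWeight_natAdd] at hj
    exact hB.vecMul_apply_ne_zero hj (congrFun hvB j)
  | left j =>
    simp only [sum_peelWeight_castAdd, Finset.mem_filter_univ] at hj
    by_cases hμv : μ ≠ 0 ∧ v j ≠ 0
    · rw [if_pos hμv.2, if_neg hμv.1, Nat.add_eq_right] at hj
      refine mul_ne_zero hμv.1 hμv.2 ?_
      rw [← hA.vecMul_apply_eq_zero hj, hvA, Pi.smul_apply, smul_eq_mul]
    · have hdiag : (if v j ≠ 0 then if μ = 0 then 0 else 1 else 0) = 0 := by grind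
      rw [hdiag, add_zero] at hj
      refine hA.vecMul_apply_ne_zero hj ?_
      rw [hvA, Pi.smul_apply, smul_eq_mul, mul_eq_zero]
      tauto

variable (𝔽 : Type*) [RCLike 𝔽]

theorem peelable_of_strongStructControllable (h : StrongStructControllable 𝔽 𝒜 ℬ) {δ : ℕ}
    (hδ : δ ≤ 1) : Peelable (peelWeight δ (pairMatrix 𝒜 ℬ)) := by
  by_contra hpeel
  simp only [Peelable, not_forall, not_exists, exists_prop] at hpeel
  obtain ⟨V, ⟨i₀, hi₀⟩, hV⟩ := hpeel
  obtain ⟨A, hA, hsumA⟩ := exists_hasNonzeroStructure_sum_eq (K := 𝔽) 𝒜 V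
    (fun j => if j ∈ V then δ else 0) (fun j => by split_ifs <;> omega)
    fun j => sum_peelWeight_castAdd (ℬ := ℬ) δ V j ▸ hV (Fin.castAdd r j)
  obtain ⟨B, hB, hsumB⟩ := exists_hasNonzeroStructure_sum_eq (K := 𝔽) ℬ V 0
    (fun _ => zero_le_one) fun j => sum_peelWeight_natAdd (𝒜 := 𝒜) δ V j ▸ hV (Fin.natAdd n j)
  let v : Fin n → 𝔽 := fun i => if i ∈ V then 1 else 0
  have hvecMul : ∀ {m : ℕ} (X : Matrix (Fin n) (Fin m) 𝔽) (j : Fin m),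
      (v ᵥ* X) j = ∑ i ∈ V, X i j := fun X j => by simp [v, Matrix.vecMul, dotProduct]
  refine not_isControllable_of_vecMul_eq_smul (v := v) (μ := (δ : 𝔽)) (fun h0 => ?_)
    (funext fun j => ?_) (funext fun j => ?_) (h A B hA hB)
  · simpa [v, hi₀] using congrFun h0 i₀
  · rw [hvecMul, hsumA]
    simp [v]
  · rw [hvecMul, hsumB, Pi.zero_apply, Nat.cast_zero, Pi.zero_apply]

theorem strongStructControllable_iff_peelable :
    StrongStructControllable 𝔽 𝒜 ℬ ↔
      Peelable (peelWeight 0 (pairMatrix 𝒜 ℬ)) ∧ Peelable (peelWeight 1 (pairMatrix 𝒜 ℬ)) := by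
  classical
  refine ⟨fun h => ⟨peelable_of_strongStructControllable 𝔽 h zero_le_one,
    peelable_of_strongStructControllable 𝔽 h le_rfl⟩, fun ⟨h₀, h₁⟩ A B hA hB => ?_⟩
  by_contra hctrl
  let f := algebraMap 𝔽 (AlgebraicClosure 𝔽)
  obtain ⟨v, μ, hv, hvA, hvB⟩ := exists_left_eigenvector_of_not_isControllable f hctrl
  exact vecMul_ne_zero_of_peelable (hA.map f) (hB.map f) hv hvA (by split_ifs <;> assumption) hvB

end StrongStructControllable

section CompressedColumnStorage

variable {n m : ℕ} {𝒳 : StructMatrix n m} {colPtr rowIdx : List ℕ}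

theorem starsBefore_mono (𝒳 : StructMatrix n m) : Monotone (starsBefore 𝒳) := fun _ _ hab =>
  Finset.card_le_card (Finset.monotone_filter_right _ fun _ _ hp => ⟨hp.1.trans_le hab, hp.2⟩)

theorem starsBefore_zero (𝒳 : StructMatrix n m) : starsBefore 𝒳 0 = 0 := by
  simp only [starsBefore, Nat.not_lt_zero, false_and, Finset.filter_false, Finset.card_empty]

theorem starsBefore_eq_numStars (𝒳 : StructMatrix n m) : starsBefore 𝒳 m = numStars 𝒳 := by
  simp only [starsBefore, numStars, Fin.is_lt, true_and]

theorem eq_of_mem_Ico_apply_succ {f : ℕ → ℕ} (hf : Monotone f) {a b k : ℕ}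
    (ha : k ∈ Set.Ico (f a) (f (a + 1))) (hb : k ∈ Set.Ico (f b) (f (b + 1))) : a = b := by
  by_contra hne
  exact Set.disjoint_left.1 (hf.pairwise_disjoint_on_Ico_succ hne) ha hb

theorem IsCCS.exists_position (h : IsCCS 𝒳 colPtr rowIdx)
    (p : {p : Fin n × Fin m // 𝒳 p.1 p.2 = true}) :
    ∃ k : Fin (numStars 𝒳), rowIdx[(k : ℕ)]? = some ((p.1.1 : ℕ) + 1) ∧
      (k : ℕ) ∈ Set.Ico (starsBefore 𝒳 p.1.2) (starsBefore 𝒳 (p.1.2 + 1)) := by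
  obtain ⟨-, hlen, -, hentry⟩ := h
  obtain ⟨k, hle, hlt, hk⟩ := (hentry p.1.1 p.1.2).1 p.2
  have hk_lt : k - 1 < numStars 𝒳 := hlen ▸ (List.getElem?_eq_some_iff.1 hk).1
  exact ⟨⟨k - 1, hk_lt⟩, hk, Nat.le_sub_of_add_le hle, by dsimp only; omega⟩

theorem IsCCS.exists_equiv (h : IsCCS 𝒳 colPtr rowIdx) :
    ∃ e : Fin (numStars 𝒳) ≃ {p : Fin n × Fin m // 𝒳 p.1 p.2 = true}, ∀ k : Fin (numStars 𝒳),
      rowIdx[(k : ℕ)]? = some (((e k).1.1 : ℕ) + 1) ∧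
      (k : ℕ) ∈ Set.Ico (starsBefore 𝒳 (e k).1.2) (starsBefore 𝒳 ((e k).1.2 + 1)) := by
  choose pos hrow hcol using h.exists_position
  have hinj : Function.Injective pos := fun p q hpq => by
    have hrows := hrow p
    rw [hpq, hrow q, Option.some_inj, Nat.add_right_cancel_iff, Fin.val_inj] at hrows
    have hcols := eq_of_mem_Ico_apply_succ (starsBefore_mono 𝒳) (hcol p) (hpq ▸ hcol q)
    exact Subtype.ext (Prod.ext hrows.symm (Fin.ext hcols))
  have hcard : Fintype.card {p : Fin n × Fin m // 𝒳 p.1 p.2 = true} =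
      Fintype.card (Fin (numStars 𝒳)) := by
    rw [Fintype.card_fin, Fintype.card_subtype, numStars]
  let e := (Equiv.ofBijective pos ((Fintype.bijective_iff_injective_and_card pos).2 ⟨hinj, hcard⟩))
  refine ⟨e.symm, fun k => ?_⟩
  obtain ⟨p, rfl⟩ := e.surjective k
  rw [e.symm_apply_apply]
  exact ⟨hrow p, hcol p⟩

end CompressedColumnStorage

namespace RAM

/-- Weakest precondition of a loop-free program on a machine with word bound `W`. A program that
contains a loop gets the precondition `False`. -/
def Prog.wp (W : ℕ) : Prog → (State → Prop) → State → Prop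
  | .skip, Q, σ => Q σ
  | .const d c, Q, σ => c ≤ W ∧ Q (σ.setReg d c)
  | .copy d a, Q, σ => Q (σ.setReg d (σ.reg a))
  | .add d a b, Q, σ => σ.reg a + σ.reg b ≤ W ∧ Q (σ.setReg d (σ.reg a + σ.reg b))
  | .sub d a b, Q, σ => Q (σ.setReg d (σ.reg a - σ.reg b))
  | .load d a, Q, σ => σ.mem (σ.reg a) ≤ W ∧ Q (σ.setReg d (σ.mem (σ.reg a)))
  | .store a b, Q, σ => Q (σ.setMem (σ.reg a) (σ.reg b))
  | .seq p q, Q, σ => p.wp W (q.wp W Q) σ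
  | .cond a p q, Q, σ => (0 < σ.reg a → p.wp W Q σ) ∧ (σ.reg a = 0 → q.wp W Q σ)
  | .loop _ _, _, _ => False

/-- An upper bound for the running time of a loop-free program. -/
def Prog.len : Prog → ℕ
  | .seq p q => p.len + q.len
  | .cond _ p q => p.len + q.len + 1
  | _ => 1

theorem Prog.exec_of_wp {W : ℕ} {p : Prog} {Q : State → Prop} {σ : State} (h : p.wp W Q σ) :
    ∃ t τ, Exec W p σ t τ ∧ t ≤ p.len ∧ Q τ := by
  induction p generalizing Q σ with
  | skip => exact ⟨_, _, .skip σ, le_rfl, h⟩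
  | const d c => exact ⟨_, _, .const d c σ h.1, le_rfl, h.2⟩
  | copy d a => exact ⟨_, _, .copy d a σ, le_rfl, h⟩
  | add d a b => exact ⟨_, _, .add d a b σ h.1, le_rfl, h.2⟩
  | sub d a b => exact ⟨_, _, .sub d a b σ, le_rfl, h⟩
  | load d a => exact ⟨_, _, .load d a σ h.1, le_rfl, h.2⟩
  | store a b => exact ⟨_, _, .store a b σ, le_rfl, h⟩
  | seq p q ihp ihq =>
    obtain ⟨t, τ, hp, ht, h'⟩ := ihp h
    obtain ⟨t', τ', hq, ht', h''⟩ := ihq h'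
    exact ⟨_, _, .seq p q _ _ _ _ _ hp hq, Nat.add_le_add ht ht', h''⟩
  | cond a p q ihp ihq =>
    rcases Nat.eq_zero_or_pos (σ.reg a) with ha | ha
    · obtain ⟨t, τ, hq, ht, h'⟩ := ihq (h.2 ha)
      exact ⟨_, _, .cond_zero a p q _ _ _ ha hq, by simp only [Prog.len]; omega, h'⟩
    · obtain ⟨t, τ, hp, ht, h'⟩ := ihp (h.1 ha)
      exact ⟨_, _, .cond_pos a p q _ _ _ ha hp, by simp only [Prog.len]; omega, h'⟩
  | loop a p => exact h.elim

theorem exec_loop {W a : ℕ} {p : Prog} (I : ℕ → State → Prop)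
    (hI : ∀ φ σ, I φ σ → 0 < σ.reg a → p.wp W (fun τ => ∃ φ' < φ, I φ' τ) σ) {φ : ℕ} {σ : State}
    (h : I φ σ) :
    ∃ t τ, Exec W (.loop a p) σ t τ ∧ t ≤ (p.len + 1) * φ + 1 ∧ τ.reg a = 0 ∧ ∃ φ', I φ' τ := by
  induction φ using Nat.strong_induction_on generalizing σ with
  | _ φ ih =>
    rcases Nat.eq_zero_or_pos (σ.reg a) with ha | ha
    · exact ⟨1, σ, .loop_zero a p σ ha, Nat.le_add_left _ _, ha, φ, h⟩
    · obtain ⟨t, τ, hp, ht, φ', hφ', h'⟩ := Prog.exec_of_wp (hI φ σ h ha)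
      obtain ⟨t', τ', hl, ht', h''⟩ := ih φ' hφ' h'
      have hstep : (p.len + 1) * (φ' + 1) ≤ (p.len + 1) * φ := Nat.mul_le_mul_left _ hφ'
      exact ⟨_, τ', .loop_pos a p _ _ _ _ _ ha hp hl, by rw [Nat.mul_succ] at hstep; omega, h''⟩

theorem exec_seq_of_wp {W t : ℕ} {p q : Prog} {R : State → Prop} {σ : State}
    (hp : p.wp W (fun τ => ∃ t' ρ, Exec W q τ t' ρ ∧ t' ≤ t ∧ R ρ) σ) :
    ∃ t' ρ, Exec W (.seq p q) σ t' ρ ∧ t' ≤ p.len + t ∧ R ρ := by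
  obtain ⟨t₁, τ, h₁, ht₁, t₂, ρ, h₂, ht₂, hρ⟩ := Prog.exec_of_wp hp
  exact ⟨_, ρ, .seq p q _ _ _ _ _ h₁ h₂, Nat.add_le_add ht₁ ht₂, hρ⟩

/-- The memory whose cells below `B` are given by `low`, and whose cells from `B` on hold the
entries of seven interleaved arrays. Interleaving makes room for arrays of any length. -/
def layout (B : ℕ) (low : ℕ → ℕ) (A : ℕ → ℕ → ℕ) : ℕ → ℕ :=
  fun a => if a < B then low a else A ((a - B) % 7) ((a - B) / 7)

theorem layout_of_lt {B a : ℕ} (low : ℕ → ℕ) (A : ℕ → ℕ → ℕ) (h : a < B) :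
    layout B low A a = low a := if_pos h

theorem layout_cell {q : ℕ} (hq : q < 7) (B i : ℕ) (low : ℕ → ℕ) (A : ℕ → ℕ → ℕ) :
    layout B low A (7 * i + (B + q)) = A q i := by
  have hmod : (7 * i + (B + q) - B) % 7 = q := by omega
  have hdiv : (7 * i + (B + q) - B) / 7 = i := by omega
  rw [layout, if_neg (by omega), hmod, hdiv]

theorem update_layout {q : ℕ} (hq : q < 7) (B i v : ℕ) (low : ℕ → ℕ) (A : ℕ → ℕ → ℕ) :
    Function.update (layout B low A) (7 * i + (B + q)) v =
      layout B low (Function.update A q (Function.update (A q) i v)) := by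
  funext a
  by_cases ha : a = 7 * i + (B + q)
  · rw [ha, layout_cell hq, Function.update_self, Function.update_self, Function.update_self]
  · rw [Function.update_of_ne ha, layout, layout]
    split_ifs with hlt
    · rfl
    · by_cases hmod : (a - B) % 7 = q
      · rw [hmod, Function.update_self, Function.update_of_ne (by omega)]
      · rw [Function.update_of_ne hmod]

theorem layout_zero {B : ℕ} {mem : ℕ → ℕ} (h : ∀ a, B ≤ a → mem a = 0) :
    layout B mem 0 = mem := by
  funext a
  rw [layout]
  split_ifs with ha
  · rfl
  · exact (h a (not_lt.1 ha)).symm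

infixr:60 " ;; " => RAM.Prog.seq

-- Registers and arrays are notations so that `simp` compares plain numerals.
local notation "rOutput" => 0
local notation "rAddress" => 1
local notation "rTemp" => 2
local notation "rOne" => 3
local notation "rRows" => 4
local notation "rCols" => 5
local notation "rAllRows" => 6
local notation "rBase" => 7
local notation "rColumn" => 8
local notation "rEntry" => 9
local notation "rSize" => 10
local notation "rTop" => 11
local notation "rCursor" => 12
local notation "rLeft" => 13
local notation "rEdgeRow" => 14
local notation "rEdgeCol" => 15
local notation "rTest" => 16
local notation "rContinue" => 17

local notation "aHead" => 0
local notation "aNext" => 1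
local notation "aRow" => 2
local notation "aCol" => 3
local notation "aCount" => 4
local notation "aRowSum" => 5
local notation "aStack" => 6

section Instructions

/-- Put the address of entry `reg i` of array `q` into `rAddress`. -/
def address (q i : ℕ) : Prog :=
  .const rAddress q ;; .add rAddress rBase rAddress ;; .add rAddress rAddress i ;;
  .add rAddress rAddress i ;; .add rAddress rAddress i ;; .add rAddress rAddress i ;;
  .add rAddress rAddress i ;; .add rAddress rAddress i ;; .add rAddress rAddress i

/-- Read entry `reg i` of array `q` into register `d`. -/
def readArr (d q i : ℕ) : Prog := address q i ;; .load d rAddress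

/-- Write register `b` to entry `reg i` of array `q`. -/
def writeArr (q i b : ℕ) : Prog := address q i ;; .store rAddress b

/-- Reduce `rTemp` modulo `rAllRows`, provided that it is less than twice that number. -/
def reduceMod : Prog :=
  .add rTest rTemp rOne ;; .sub rTest rTest rAllRows ;;
  .cond rTest (.sub rTemp rTemp rAllRows) .skip

variable {W B N q i b d x y k : ℕ} {Q : State → Prop} {g mem low : ℕ → ℕ} {A : ℕ → ℕ → ℕ}

theorem wp_seq {p p' : Prog} : (p ;; p').wp W Q = p.wp W (p'.wp W Q) := rfl

theorem wp_const (hk : k ≤ W) (hQ : Q ⟨Function.update g d k, mem⟩) :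
    (Prog.const d k).wp W Q ⟨g, mem⟩ := ⟨hk, hQ⟩

theorem wp_copy (hx : g i = x) (hQ : Q ⟨Function.update g d x, mem⟩) :
    (Prog.copy d i).wp W Q ⟨g, mem⟩ := by
  subst hx
  exact hQ

theorem wp_add (hx : g i = x) (hy : g b = y) (hW : x + y ≤ W)
    (hQ : Q ⟨Function.update g d (x + y), mem⟩) : (Prog.add d i b).wp W Q ⟨g, mem⟩ := by
  subst hx hy
  exact ⟨hW, hQ⟩

theorem wp_sub (hx : g i = x) (hy : g b = y) (hQ : Q ⟨Function.update g d (x - y), mem⟩) :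
    (Prog.sub d i b).wp W Q ⟨g, mem⟩ := by
  subst hx hy
  exact hQ

theorem wp_load (hk : g i = k) (hx : mem k = x) (hW : x ≤ W)
    (hQ : Q ⟨Function.update g d x, mem⟩) : (Prog.load d i).wp W Q ⟨g, mem⟩ := by
  subst hk hx
  exact ⟨hW, hQ⟩

theorem wp_cond {p p' : Prog} (hx : g i = x) (hpos : 0 < x → p.wp W Q ⟨g, mem⟩)
    (hzero : x = 0 → p'.wp W Q ⟨g, mem⟩) : (Prog.cond i p p').wp W Q ⟨g, mem⟩ := by
  subst hx
  exact ⟨hpos, hzero⟩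

theorem wp_address (hi : i ≠ rAddress) (hB : g rBase = B) (hk : g i = k)
    (hW : 7 * k + (B + q) ≤ W) (hQ : Q ⟨Function.update g rAddress (7 * k + (B + q)), mem⟩) :
    (address q i).wp W Q ⟨g, mem⟩ := by
  subst hB hk
  have haddr : g 7 + q + g i + g i + g i + g i + g i + g i + g i = 7 * g i + (g 7 + q) := by ring
  simp only [address, Prog.wp, State.setReg, Function.update_self, Function.update_idem,
    Function.update_of_ne hi, ne_eq, OfNat.ofNat_ne_one, not_false_eq_true, Function.update_of_ne,
    haddr]
  exact ⟨by omega, by omega, by omega, by omega, by omega, by omega, by omega, by omega, by omega,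
    hQ⟩

theorem wp_readArr (hB : g rBase = B) (hk : g i = k) (hW : 7 * k + (B + q) ≤ W) (hx : A q k = x)
    (hxW : x ≤ W)
    (hQ : ∀ a, Q ⟨Function.update (Function.update g rAddress a) d x, layout B low A⟩)
    (hq : q < 7 := by decide) (hi : i ≠ rAddress := by decide) :
    (readArr d q i).wp W Q ⟨g, layout B low A⟩ :=
  wp_address hi hB hk hW <|
    wp_load (Function.update_self ..) ((layout_cell hq ..).trans hx) hxW (hQ _)

theorem wp_writeArr (hB : g rBase = B) (hk : g i = k) (hW : 7 * k + (B + q) ≤ W) (hx : g b = x)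
    (hQ : ∀ a, Q ⟨Function.update g rAddress a,
      layout B low (Function.update A q (Function.update (A q) k x))⟩)
    (hq : q < 7 := by decide) (hi : i ≠ rAddress := by decide) (hb : b ≠ rAddress := by decide) :
    (writeArr q i b).wp W Q ⟨g, layout B low A⟩ := by
  refine wp_address hi hB hk hW ?_
  simpa only [Prog.wp, State.setMem, Function.update_self, Function.update_of_ne hb, hx,
    update_layout hq] using hQ _

theorem wp_reduceMod (hone : g rOne = 1) (hN : g rAllRows = N) (hx : g rTemp = x)
    (hlt : x < 2 * N) (hW : x + 1 ≤ W)
    (hQ : ∀ y, Q ⟨Function.update (Function.update g rTest y) rTemp (x % N), mem⟩) :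
    reduceMod.wp W Q ⟨g, mem⟩ := by
  subst hx
  simp only [reduceMod, Prog.wp, State.setReg, Function.update_self, Function.update_idem, hone, hN,
    ne_eq, Nat.reduceEqDiff, not_false_eq_true, Function.update_of_ne]
  refine ⟨hW, fun hpos => ?_, fun hzero => ?_⟩
  · rw [← Nat.mod_eq_of_lt (show g 2 - N < N by omega), ← Nat.mod_eq_sub_mod (by omega)]
    exact hQ _
  · convert hQ (g 2 + 1 - N) using 2
    rw [Nat.mod_eq_of_lt (by omega), eq_comm, Function.update_eq_self_iff,
      Function.update_of_ne (by norm_num)]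

end Instructions

open Finset

/-- The contents of the registers and arrays in which the program keeps its data: a multigraph
between rows and columns with edges `1, …, size`, where the edges of each row form a linked list
that ends with `0`, and a stack of columns. Edges before `cursor` in the list of its row, and
`cursor` itself, are waiting to be removed. -/
structure Vars where
  column : ℕ
  entry : ℕ
  size : ℕ
  top : ℕ
  cursor : ℕ
  left : ℕ
  head : ℕ → ℕ
  next : ℕ → ℕ
  row : ℕ → ℕ
  col : ℕ → ℕ
  count : ℕ → ℕ
  rowSum : ℕ → ℕ
  stack : ℕ → ℕ

namespace Vars

variable {N M r c : ℕ} {v : Vars} {L R : Finset ℕ}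

/-- The variables after an edge in row `r` and column `c` is added; `N` is the modulus of the sums
of rows. -/
@[simps] def addEdge (N r c : ℕ) (v : Vars) : Vars :=
  { v with
    size := v.size + 1
    head := Function.update v.head r (v.size + 1)
    next := Function.update v.next (v.size + 1) (v.head r)
    row := Function.update v.row (v.size + 1) r
    col := Function.update v.col (v.size + 1) c
    count := Function.update v.count c (v.count c + 1)
    rowSum := Function.update v.rowSum c ((v.rowSum c + r) % N)
    stack := Function.update v.stack (v.size + 1) c }

/-- The variables after the edge `cursor` is removed and its column is pushed. -/
@[simps] def removeEdge (N : ℕ) (v : Vars) : Vars :=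
  { v with
    top := v.top + 1
    cursor := v.next v.cursor
    count := Function.update v.count (v.col v.cursor) (v.count (v.col v.cursor) - 1)
    rowSum := Function.update v.rowSum (v.col v.cursor)
      ((v.rowSum (v.col v.cursor) + N - v.row v.cursor) % N)
    stack := Function.update v.stack (v.top + 1) (v.col v.cursor) }

/-- The variables after a column is popped; if it has a single edge, then the removal of all edges
in the row of that edge begins. -/
def popColumn (v : Vars) : Vars :=
  if v.count (v.stack v.top) = 1 then
    { v with
      top := v.top - 1
      cursor := v.head (v.rowSum (v.stack v.top))
      left := v.left - 1 }
  else { v with top := v.top - 1 }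

theorem popColumn_size : v.popColumn.size = v.size := by
  rw [popColumn]
  split_ifs <;> rfl

theorem popColumn_top : v.popColumn.top = v.top - 1 := by
  rw [popColumn]
  split_ifs <;> rfl

/-- The rows and columns of the edges are less than `N` and `M`, and the edges of each row are
linked in decreasing order. -/
structure Linked (N M : ℕ) (v : Vars) : Prop where
  row_lt : ∀ e ∈ Icc 1 v.size, v.row e < N
  col_lt : ∀ e ∈ Icc 1 v.size, v.col e < M
  head_eq : ∀ i, v.head i = Nat.findGreatest (v.row · = i) v.size
  next_eq : ∀ e ∈ Icc 1 v.size, v.next e = Nat.findGreatest (v.row · = v.row e) (e - 1)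

/-- For each column, `count` is the number of its edges in `L`, and `rowSum` is the sum of their
rows modulo `N`. If the number is one, the sum thus is the row of the only edge. -/
structure Tallied (N : ℕ) (L : Finset ℕ) (v : Vars) : Prop where
  count_eq : ∀ j, v.count j = #{e ∈ L | v.col e = j}
  rowSum_eq : ∀ j, v.rowSum j = (∑ e ∈ L with v.col e = j, v.row e) % N

/-- The multigraph is complete: no row has been removed, and the stack records the columns of all
edges. -/
structure Intact (N M : ℕ) (v : Vars) : Prop where
  linked : v.Linked N M
  tallied : v.Tallied N (Icc 1 v.size)
  stack_eq : ∀ e ∈ Icc 1 v.size, v.stack e = v.col e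
  cursor_eq : v.cursor = 0
  left_eq : v.left = N

theorem update_eq_of_mem_Icc {e : ℕ} (f : ℕ → ℕ) (x : ℕ) (he : e ∈ Icc 1 v.size) :
    Function.update f (v.size + 1) x e = f e :=
  Function.update_of_ne (Nat.lt_succ_of_le (mem_Icc.1 he).2).ne _ _

theorem findGreatest_update_of_le {k : ℕ} (f : ℕ → ℕ) (i x : ℕ) (hk : k ≤ v.size) :
    Nat.findGreatest (Function.update f (v.size + 1) x · = i) k =
      Nat.findGreatest (f · = i) k := by
  induction k with
  | zero => rfl
  | succ k ih =>
    rw [Nat.findGreatest_succ, Nat.findGreatest_succ, ih (k.le_succ.trans hk),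
      update_eq_of_mem_Icc f x (mem_Icc.2 ⟨Nat.le_add_left _ _, hk⟩)]

theorem forall_mem_Icc_succ {p : ℕ → Prop} {k : ℕ} :
    (∀ e ∈ Icc 1 (k + 1), p e) ↔ (∀ e ∈ Icc 1 k, p e) ∧ p (k + 1) := by
  rw [← insert_Icc_right_eq_Icc_add_one (Nat.le_add_left 1 k), forall_mem_insert, and_comm]

theorem Linked.addEdge (h : v.Linked N M) (hr : r < N) (hc : c < M) :
    (v.addEdge N r c).Linked N M where
  row_lt := forall_mem_Icc_succ.2 ⟨fun e he => by
    rw [addEdge_row, update_eq_of_mem_Icc _ _ he]; exact h.row_lt e he, by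
    rwa [addEdge_row, Function.update_self]⟩
  col_lt := forall_mem_Icc_succ.2 ⟨fun e he => by
    rw [addEdge_col, update_eq_of_mem_Icc _ _ he]; exact h.col_lt e he, by
    rwa [addEdge_col, Function.update_self]⟩
  head_eq i := by
    simp only [addEdge_head, addEdge_row, addEdge_size, Nat.findGreatest_succ,
      Function.update_self, findGreatest_update_of_le _ _ _ le_rfl, Function.update_apply v.head,
      h.head_eq, eq_comm (a := i)]
  next_eq := forall_mem_Icc_succ.2 ⟨fun e he => by
    have hle : e - 1 ≤ v.size := (Nat.sub_le _ _).trans (mem_Icc.1 he).2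
    simp only [addEdge_next, addEdge_row, update_eq_of_mem_Icc _ _ he,
      findGreatest_update_of_le _ _ _ hle, h.next_eq e he], by
    simp only [addEdge_next, addEdge_row, Function.update_self, Nat.add_sub_cancel,
      findGreatest_update_of_le _ _ _ le_rfl, h.head_eq]⟩

theorem sum_addEdge {α : Type*} [AddCommMonoid α] (F : ℕ → ℕ → α) :
    ∑ e ∈ Icc 1 (v.addEdge N r c).size, F ((v.addEdge N r c).row e) ((v.addEdge N r c).col e) =
      ∑ e ∈ Icc 1 v.size, F (v.row e) (v.col e) + F r c := by
  rw [addEdge_size, sum_Icc_succ_top (Nat.le_add_left _ _), addEdge_row, addEdge_col,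
    Function.update_self, Function.update_self]
  congr 1
  refine sum_congr rfl fun e he => ?_
  rw [addEdge_row, addEdge_col, update_eq_of_mem_Icc _ _ he, update_eq_of_mem_Icc _ _ he]

theorem Tallied.addEdge (h : v.Tallied N (Icc 1 v.size)) :
    (v.addEdge N r c).Tallied N (Icc 1 (v.addEdge N r c).size) where
  count_eq j := by
    rw [card_filter, sum_addEdge fun _ k => if k = j then 1 else 0, ← card_filter, ← h.count_eq,
      addEdge_count]
    rcases eq_or_ne c j with rfl | hcj
    · rw [Function.update_self, if_pos rfl]
    · rw [Function.update_of_ne hcj.symm, if_neg hcj, add_zero]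
  rowSum_eq j := by
    rw [sum_filter, sum_addEdge fun i k => if k = j then i else 0, ← sum_filter, Nat.add_mod,
      ← h.rowSum_eq, addEdge_rowSum]
    rcases eq_or_ne c j with rfl | hcj
    · rw [Function.update_self, if_pos rfl, Nat.add_mod_mod]
    · rw [Function.update_of_ne hcj.symm, if_neg hcj, Nat.zero_mod, add_zero, h.rowSum_eq,
        Nat.mod_mod]

theorem Intact.addEdge (h : v.Intact N M) (hr : r < N) (hc : c < M) :
    (v.addEdge N r c).Intact N M where
  linked := h.linked.addEdge hr hc
  tallied := h.tallied.addEdge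
  stack_eq := forall_mem_Icc_succ.2 ⟨fun e he => by
    rw [addEdge_stack, addEdge_col, update_eq_of_mem_Icc _ _ he, update_eq_of_mem_Icc _ _ he,
      h.stack_eq e he], by
    rw [addEdge_stack, addEdge_col, Function.update_self, Function.update_self]⟩
  cursor_eq := h.cursor_eq
  left_eq := h.left_eq

theorem Intact.with_positions (h : v.Intact N M) (column entry top : ℕ) :
    Intact N M { v with column, entry, top } :=
  ⟨⟨h.linked.1, h.linked.2, h.linked.3, h.linked.4⟩, ⟨h.tallied.1, h.tallied.2⟩, h.stack_eq,
    h.cursor_eq, h.left_eq⟩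

theorem Tallied.count_le (h : v.Tallied N L) (j : ℕ) : v.count j ≤ #L :=
  (h.count_eq j).trans_le (card_filter_le _ _)

theorem Tallied.rowSum_lt (h : v.Tallied N L) (hN : 0 < N) (j : ℕ) : v.rowSum j < N :=
  (h.rowSum_eq j).trans_lt (Nat.mod_lt _ hN)

/-- The edges in the rows `R` and the edges that are waiting to be removed. -/
def live (v : Vars) (R : Finset ℕ) : Finset ℕ :=
  {e ∈ Icc 1 v.size | v.row e ∈ R ∨ v.row e = v.row v.cursor ∧ e ≤ v.cursor}

/-- The number of edges in column `j` and the rows `V`. -/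
def degree (v : Vars) (V : Finset ℕ) (j : ℕ) : ℕ :=
  #{e ∈ Icc 1 v.size | v.row e ∈ V ∧ v.col e = j}

/-- The invariant of the peeling loop; `R` is the set of the rows that have not been removed. -/
structure Peeling (N M : ℕ) (R : Finset ℕ) (v : Vars) : Prop where
  linked : v.Linked N M
  tallied : v.Tallied N (v.live R)
  cursor_le : v.cursor ≤ v.size
  row_cursor_notMem : 0 < v.cursor → v.row v.cursor ∉ R
  card_live_add_top_le : #(v.live R) + v.top ≤ 2 * v.size
  stack_lt : ∀ s ∈ Icc 1 v.top, v.stack s < M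
  /-- A column with a single live edge will be inspected: it is on the stack or will be pushed. -/
  waiting : ∀ j, v.count j = 1 → (∃ s ∈ Icc 1 v.top, v.stack s = j) ∨
    ∃ e ∈ Icc 1 v.cursor, v.row e = v.row v.cursor ∧ v.col e = j
  left_eq : v.left = #R
  rows_subset : R ⊆ range N
  subset_rows : ∀ V ⊆ range N, (∀ j < M, v.degree V j ≠ 1) → V ⊆ R

theorem Tallied.eq_row_of_count_eq_one (h : v.Tallied N L) {j : ℕ} (hcount : v.count j = 1)
    (hlt : ∀ e ∈ L, v.row e < N) : ∃ e, {e ∈ L | v.col e = j} = {e} ∧ v.rowSum j = v.row e := by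
  obtain ⟨e, he⟩ := card_eq_one.1 ((h.count_eq j).symm.trans hcount)
  have he_mem : e ∈ L := (mem_filter.1 (he ▸ mem_singleton_self e)).1
  exact ⟨e, he, by rw [h.rowSum_eq, he, sum_singleton, Nat.mod_eq_of_lt (hlt e he_mem)]⟩

theorem Linked.le_next_iff (h : v.Linked N M) {d e : ℕ} (he : e ∈ Icc 1 v.size)
    (hrow : v.row d = v.row e) : d ≤ v.next e ↔ d < e := by
  have he_pos := (mem_Icc.1 he).1
  rw [h.next_eq e he]
  exact ⟨fun hd => by have := Nat.findGreatest_le (P := (v.row · = v.row e)) (e - 1); omega,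
    fun hd => Nat.le_findGreatest (Nat.le_sub_one_of_lt hd) hrow⟩

theorem Linked.next_lt (h : v.Linked N M) {e : ℕ} (he : e ∈ Icc 1 v.size) : v.next e < e :=
  not_le.1 fun hle => lt_irrefl e ((h.le_next_iff he rfl).1 hle)

theorem Linked.row_next (h : v.Linked N M) {e : ℕ} (he : e ∈ Icc 1 v.size) (hpos : 0 < v.next e) :
    v.row (v.next e) = v.row e := by
  rw [h.next_eq e he] at hpos ⊢
  exact Nat.findGreatest_of_ne_zero (P := (v.row · = v.row e)) rfl hpos.ne'

theorem Linked.before_next_iff (h : v.Linked N M) {d e : ℕ} (he : e ∈ Icc 1 v.size)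
    (hd : d ∈ Icc 1 v.size) :
    v.row d = v.row (v.next e) ∧ d ≤ v.next e ↔ v.row d = v.row e ∧ d < e := by
  have hd_pos := (mem_Icc.1 hd).1
  constructor
  · rintro ⟨hrow, hle⟩
    rw [h.row_next he (hd_pos.trans hle)] at hrow
    exact ⟨hrow, (h.le_next_iff he hrow).1 hle⟩
  · rintro ⟨hrow, hlt⟩
    have hle := (h.le_next_iff he hrow).2 hlt
    exact ⟨hrow.trans (h.row_next he (hd_pos.trans hle)).symm, hle⟩

theorem Linked.row_head (h : v.Linked N M) {e : ℕ} (he : e ∈ Icc 1 v.size) :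
    v.row (v.head (v.row e)) = v.row e := by
  rw [h.head_eq]
  exact Nat.findGreatest_spec (P := (v.row · = v.row e)) (mem_Icc.1 he).2 rfl

theorem Linked.le_head (h : v.Linked N M) {e : ℕ} (he : e ∈ Icc 1 v.size) :
    e ≤ v.head (v.row e) := by
  rw [h.head_eq]
  exact Nat.le_findGreatest (mem_Icc.1 he).2 rfl

theorem Linked.head_le (h : v.Linked N M) (i : ℕ) : v.head i ≤ v.size :=
  (h.head_eq i).trans_le (Nat.findGreatest_le _)

theorem card_live_le (v : Vars) (R : Finset ℕ) : #(v.live R) ≤ v.size :=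
  (card_filter_le _ _).trans_eq (Nat.card_Icc 1 v.size)

theorem Tallied.removeEdge (h : v.Tallied N L) (hcursor : v.cursor ∈ L)
    (hrow : v.row v.cursor ≤ N) : (v.removeEdge N).Tallied N (L.erase v.cursor) where
  count_eq j := by
    simp only [removeEdge_count, removeEdge_col, filter_erase]
    rcases eq_or_ne j (v.col v.cursor) with rfl | hj
    · have hmem : v.cursor ∈ {e ∈ L | v.col e = v.col v.cursor} := mem_filter.2 ⟨hcursor, rfl⟩
      rw [Function.update_self, card_erase_of_mem hmem, h.count_eq]
    · rw [Function.update_of_ne hj, h.count_eq, erase_eq_of_notMem fun hmem =>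
        hj (mem_filter.1 hmem).2.symm]
  rowSum_eq j := by
    simp only [removeEdge_rowSum, removeEdge_col, removeEdge_row, filter_erase]
    rcases eq_or_ne j (v.col v.cursor) with rfl | hj
    · have hmem : v.cursor ∈ {e ∈ L | v.col e = v.col v.cursor} := mem_filter.2 ⟨hcursor, rfl⟩
      rw [Function.update_self, h.rowSum_eq,
        ← add_sum_erase _ _ hmem, Nat.add_sub_assoc hrow, Nat.mod_add_mod,
        add_right_comm, Nat.add_sub_of_le hrow, Nat.add_mod_left]
    · rw [Function.update_of_ne hj, h.rowSum_eq, erase_eq_of_notMem fun hmem =>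
        hj (mem_filter.1 hmem).2.symm]

theorem mem_live_of_cursor_eq_zero (hcursor : v.cursor = 0) {e : ℕ} :
    e ∈ v.live R ↔ e ∈ Icc 1 v.size ∧ v.row e ∈ R := by
  rw [live, mem_filter, hcursor]
  exact and_congr_right fun he =>
    or_iff_left fun hle => Nat.not_succ_le_zero _ ((mem_Icc.1 he).1.trans hle.2)

namespace Peeling

theorem cursor_mem_Icc (h : v.Peeling N M R) (hpos : 0 < v.cursor) : v.cursor ∈ Icc 1 v.size :=
  mem_Icc.2 ⟨hpos, h.cursor_le⟩

theorem cursor_mem_live (h : v.Peeling N M R) (hpos : 0 < v.cursor) : v.cursor ∈ v.live R :=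
  mem_filter.2 ⟨h.cursor_mem_Icc hpos, .inr ⟨rfl, le_rfl⟩⟩

theorem top_lt (h : v.Peeling N M R) (hpos : 0 < v.cursor) : v.top < 2 * v.size := by
  have := h.card_live_add_top_le
  have := card_pos.2 ⟨_, h.cursor_mem_live hpos⟩
  omega

theorem live_removeEdge (h : v.Peeling N M R) (hpos : 0 < v.cursor) :
    (v.removeEdge N).live R = (v.live R).erase v.cursor := by
  have hmem := h.cursor_mem_Icc hpos
  ext e
  simp only [live, mem_filter, mem_erase, removeEdge_size, removeEdge_row, removeEdge_cursor]
  rcases em' (e ∈ Icc 1 v.size) with he | he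
  · simp only [he, false_and, and_false]
  rw [h.linked.before_next_iff hmem he]
  rcases eq_or_ne e v.cursor with rfl | hne
  · simp only [he, h.row_cursor_notMem hpos, lt_irrefl, and_false, or_self, ne_eq,
      not_true_eq_false, false_and]
  · simp only [he, hne.le_iff_lt, ne_eq, hne, not_false_eq_true, true_and]

theorem removeEdge (h : v.Peeling N M R) (hpos : 0 < v.cursor) :
    (v.removeEdge N).Peeling N M R := by
  have hmem := h.cursor_mem_Icc hpos
  have hlive := h.live_removeEdge hpos
  have hcard := card_erase_add_one (h.cursor_mem_live hpos)
  have hsize := h.card_live_add_top_le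
  have hnext_lt := (h.linked.next_lt hmem)
  refine ⟨⟨h.linked.1, h.linked.2, h.linked.3, h.linked.4⟩,
    hlive ▸ h.tallied.removeEdge (h.cursor_mem_live hpos) (h.linked.row_lt _ hmem).le,
    hnext_lt.le.trans h.cursor_le, ?_, ?_, ?_, ?_, h.left_eq, h.rows_subset, h.subset_rows⟩
  · rw [removeEdge_cursor, removeEdge_row]
    exact fun hnext => (h.linked.row_next hmem hnext).symm ▸ h.row_cursor_notMem hpos
  · rw [hlive, removeEdge_top, removeEdge_size]
    omega
  · exact forall_mem_Icc_succ.2 ⟨fun s hs => by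
      rw [removeEdge_stack, Function.update_of_ne (Nat.lt_succ_of_le (mem_Icc.1 hs).2).ne]
      exact h.stack_lt s hs, by
      rw [removeEdge_stack, Function.update_self]
      exact h.linked.col_lt _ hmem⟩
  · intro j hj
    simp only [removeEdge_top, removeEdge_stack, removeEdge_cursor, removeEdge_row, removeEdge_col]
    rw [removeEdge_count] at hj
    rcases eq_or_ne j (v.col v.cursor) with rfl | hne
    · exact .inl ⟨v.top + 1, right_mem_Icc.2 (Nat.le_add_left _ _), Function.update_self ..⟩
    rw [Function.update_of_ne hne] at hj
    rcases h.waiting j hj with ⟨s, hs, rfl⟩ | ⟨e, he, hrow, rfl⟩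
    · have hs_lt := Nat.lt_succ_of_le (mem_Icc.1 hs).2
      exact .inl ⟨s, mem_Icc.2 ⟨(mem_Icc.1 hs).1, hs_lt.le⟩, Function.update_of_ne hs_lt.ne ..⟩
    · have he_size := Icc_subset_Icc_right h.cursor_le he
      have he_lt := (mem_Icc.1 he).2.lt_of_ne fun heq => hne (heq ▸ rfl)
      obtain ⟨hrow', hle⟩ := (h.linked.before_next_iff hmem he_size).2 ⟨hrow, he_lt⟩
      exact .inr ⟨e, mem_Icc.2 ⟨(mem_Icc.1 he).1, hle⟩, hrow', rfl⟩

theorem popColumn_of_count_ne_one (h : v.Peeling N M R) (hcount : v.count (v.stack v.top) ≠ 1) :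
    v.popColumn.Peeling N M R := by
  rw [Vars.popColumn, if_neg hcount]
  refine ⟨⟨h.linked.1, h.linked.2, h.linked.3, h.linked.4⟩, ⟨h.tallied.1, h.tallied.2⟩,
    h.cursor_le, h.row_cursor_notMem,
    (Nat.add_le_add_left (Nat.sub_le _ _) _).trans h.card_live_add_top_le,
    fun s hs => h.stack_lt s (Icc_subset_Icc_right (Nat.sub_le _ _) hs), fun j hj => ?_,
    h.left_eq, h.rows_subset, h.subset_rows⟩
  refine (h.waiting j hj).imp_left fun ⟨s, hs, hsj⟩ => ⟨s, ?_, hsj⟩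
  have hs_top : s ≠ v.top := fun heq => hcount (heq ▸ hsj ▸ hj)
  exact mem_Icc.2 ⟨(mem_Icc.1 hs).1, Nat.le_sub_one_of_lt ((mem_Icc.1 hs).2.lt_of_ne hs_top)⟩

theorem live_head (h : v.Peeling N M R) (hcursor : v.cursor = 0) {e : ℕ} (he : e ∈ Icc 1 v.size)
    (hrow : v.row e ∈ R) :
    live { v with cursor := v.head (v.row e) } (R.erase (v.row e)) = v.live R := by
  ext d
  rw [mem_live_of_cursor_eq_zero hcursor, live, mem_filter, h.linked.row_head he, mem_erase]
  refine and_congr_right fun hd => ?_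
  rcases eq_or_ne (v.row d) (v.row e) with heq | hne
  · simp only [heq, hrow, heq ▸ h.linked.le_head hd, and_self, or_true]
  · simp only [hne, ne_eq, not_false_eq_true, true_and, false_and, or_false]

theorem popColumn_of_count_eq_one (h : v.Peeling N M R) (hcursor : v.cursor = 0) (htop : 0 < v.top)
    (hcount : v.count (v.stack v.top) = 1) :
    ∃ R', v.popColumn.Peeling N M R' ∧ v.popColumn.live R' = v.live R := by
  obtain ⟨e, he, hsum⟩ := h.tallied.eq_row_of_count_eq_one hcount fun e he =>
    h.linked.row_lt e (mem_filter.1 he).1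
  have hmem (d : ℕ) :
      d = e ↔ (d ∈ Icc 1 v.size ∧ v.row d ∈ R) ∧ v.col d = v.stack v.top := by
    rw [← mem_singleton, ← he, mem_filter, mem_live_of_cursor_eq_zero hcursor]
  obtain ⟨⟨he_size, he_row⟩, he_col⟩ := (hmem e).1 rfl
  rw [Vars.popColumn, if_pos hcount, hsum]
  have hlive : live { v with top := v.top - 1, cursor := v.head (v.row e), left := v.left - 1 }
      (R.erase (v.row e)) = v.live R := h.live_head hcursor he_size he_row
  refine ⟨R.erase (v.row e), ⟨⟨h.linked.1, h.linked.2, h.linked.3, h.linked.4⟩,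
    hlive ▸ ⟨h.tallied.1, h.tallied.2⟩, h.linked.head_le _, fun _ => ?_, hlive ▸ ?_,
    fun s hs => h.stack_lt s (Icc_subset_Icc_right (Nat.sub_le _ _) hs), fun j hj => ?_, ?_,
    (erase_subset _ _).trans h.rows_subset, fun V hV hdegree => ?_⟩, hlive⟩
  · exact (h.linked.row_head he_size).symm ▸ notMem_erase _ _
  · exact (Nat.add_le_add_left (Nat.sub_le _ _) _).trans h.card_live_add_top_le
  · rcases h.waiting j hj with ⟨s, hs, rfl⟩ | ⟨d, hd, -⟩
    · rcases (mem_Icc.1 hs).2.eq_or_lt with rfl | hlt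
      · exact .inr ⟨e, mem_Icc.2 ⟨(mem_Icc.1 he_size).1, h.linked.le_head he_size⟩,
          (h.linked.row_head he_size).symm, he_col⟩
      · exact .inl ⟨s, mem_Icc.2 ⟨(mem_Icc.1 hs).1, Nat.le_sub_one_of_lt hlt⟩, rfl⟩
    · rw [hcursor] at hd
      exact absurd hd (notMem_empty d)
  · exact h.left_eq ▸ (card_erase_of_mem he_row).symm
  · have hVR := h.subset_rows V hV hdegree
    refine subset_erase.2 ⟨hVR, fun heV => hdegree _ (h.stack_lt _ (right_mem_Icc.2 htop)) ?_⟩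
    refine card_eq_one.2 ⟨e, ext fun d => ?_⟩
    rw [mem_filter, mem_singleton]
    refine ⟨fun ⟨hd, hdV, hdj⟩ => (hmem d).2 ⟨⟨hd, hVR hdV⟩, hdj⟩, ?_⟩
    rintro rfl
    exact ⟨he_size, heV, he_col⟩

theorem popColumn (h : v.Peeling N M R) (hcursor : v.cursor = 0) (htop : 0 < v.top) :
    ∃ R', v.popColumn.Peeling N M R' ∧ v.popColumn.live R' = v.live R := by
  by_cases hcount : v.count (v.stack v.top) = 1
  · exact h.popColumn_of_count_eq_one hcursor htop hcount
  · exact ⟨R, h.popColumn_of_count_ne_one hcount, by rw [Vars.popColumn, if_neg hcount]; rfl⟩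

end Peeling

/-- The number of edges between each row and each column. -/
def multiplicity (N M : ℕ) (v : Vars) : Matrix (Fin N) (Fin M) ℕ :=
  Matrix.of fun i j => #{e ∈ Icc 1 v.size | v.row e = i ∧ v.col e = j}

theorem multiplicity_removeEdge : (v.removeEdge N).multiplicity N M = v.multiplicity N M := rfl

theorem multiplicity_popColumn : v.popColumn.multiplicity N M = v.multiplicity N M := by
  rw [popColumn]
  split_ifs <;> rfl

theorem sum_multiplicity (v : Vars) (V : Finset (Fin N)) (j : Fin M) :
    ∑ i ∈ V, v.multiplicity N M i j = v.degree (V.map Fin.valEmbedding) j := by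
  rw [degree, card_eq_sum_card_fiberwise (f := v.row) (t := V.map Fin.valEmbedding)
    fun e he => (mem_filter.1 he).2.1, sum_map]
  refine sum_congr rfl fun i hi => ?_
  rw [multiplicity, Matrix.of_apply]
  congr 1 with e
  simp only [mem_filter, Fin.valEmbedding_apply]
  exact ⟨fun ⟨he, hrow, hcol⟩ => ⟨⟨he, hrow ▸ mem_map_of_mem _ hi, hcol⟩, hrow⟩,
    fun ⟨⟨he, _, hcol⟩, hrow⟩ => ⟨he, hrow, hcol⟩⟩

theorem Intact.peeling (h : v.Intact N M) (htop : v.top = v.size) : v.Peeling N M (range N) := by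
  have hlive : v.live (range N) = Icc 1 v.size := filter_true_of_mem fun e he =>
    .inl (mem_range.2 (h.linked.row_lt e he))
  refine ⟨h.linked, hlive.symm ▸ h.tallied, h.cursor_eq ▸ Nat.zero_le _, fun hpos => ?_, ?_, ?_,
    fun j hj => ?_, h.left_eq.trans (card_range N).symm, Subset.rfl, fun _ hV _ => hV⟩
  · exact absurd h.cursor_eq hpos.ne'
  · rw [hlive, Nat.card_Icc, htop]
    omega
  · rw [htop]
    exact fun e he => h.stack_eq e he ▸ h.linked.col_lt e he
  · obtain ⟨e, he⟩ := card_eq_one.1 ((h.tallied.count_eq j).symm.trans hj)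
    obtain ⟨he_mem, he_col⟩ := mem_filter.1 (he ▸ mem_singleton_self e)
    exact .inl ⟨e, htop ▸ he_mem, (h.stack_eq e he_mem).trans he_col⟩

theorem Peeling.left_eq_zero_iff (h : v.Peeling N M R) (hcursor : v.cursor = 0) (htop : v.top = 0) :
    v.left = 0 ↔ Peelable (v.multiplicity N M) := by
  rw [h.left_eq, card_eq_zero]
  constructor
  · rintro rfl V ⟨i, hi⟩
    by_contra! hsum
    refine notMem_empty _ (h.subset_rows (V.map Fin.valEmbedding) (fun k hk => ?_) (fun j hj => ?_)
      (mem_map_of_mem _ hi))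
    · obtain ⟨k, -, rfl⟩ := mem_map.1 hk
      exact mem_range.2 k.2
    · exact v.sum_multiplicity V ⟨j, hj⟩ ▸ hsum ⟨j, hj⟩
  · intro hpeel
    by_contra! hne
    have hlt : ∀ k ∈ R, k < N := fun k hk => mem_range.1 (h.rows_subset hk)
    obtain ⟨j, hj⟩ := hpeel (R.attachFin hlt) <| by
      rwa [← card_pos, card_attachFin, card_pos]
    rw [sum_multiplicity, map_valEmbedding_attachFin] at hj
    have hcount : v.count j = 1 := by
      rw [h.tallied.count_eq, ← hj, degree]
      refine congrArg card (ext fun e => ?_)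
      rw [mem_filter, mem_live_of_cursor_eq_zero hcursor, mem_filter, and_assoc]
    rcases h.waiting j hcount with ⟨s, hs, -⟩ | ⟨e, he, -⟩
    · exact notMem_empty s (by rwa [htop] at hs)
    · exact notMem_empty e (by rwa [hcursor] at he)

end Vars

section Representation

/-- The registers `g` and the arrays `A` hold the variables `v` for a system with `n` states and
`m` columns; the arrays begin at the memory cell `B`. -/
structure Vars.Represents (n m B : ℕ) (g : ℕ → ℕ) (A : ℕ → ℕ → ℕ) (v : Vars) : Prop where
  one : g rOne = 1
  rows : g rRows = n
  cols : g rCols = m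
  allRows : g rAllRows = 2 * n
  base : g rBase = B
  column : g rColumn = v.column
  entry : g rEntry = v.entry
  size : g rSize = v.size
  top : g rTop = v.top
  cursor : g rCursor = v.cursor
  left : g rLeft = v.left
  head : A aHead = v.head
  next : A aNext = v.next
  row : A aRow = v.row
  col : A aCol = v.col
  count : A aCount = v.count
  rowSum : A aRowSum = v.rowSum
  stack : A aStack = v.stack

/-- Add an edge in row `rEdgeRow` and column `rEdgeCol`, and write its column to the stack. -/
def addEdge : Prog :=
  .add rSize rSize rOne ;;
  readArr rTemp aHead rEdgeRow ;; writeArr aNext rSize rTemp ;; writeArr aHead rEdgeRow rSize ;;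
  writeArr aRow rSize rEdgeRow ;; writeArr aCol rSize rEdgeCol ;; writeArr aStack rSize rEdgeCol ;;
  readArr rTemp aCount rEdgeCol ;; .add rTemp rTemp rOne ;; writeArr aCount rEdgeCol rTemp ;;
  readArr rTemp aRowSum rEdgeCol ;; .add rTemp rTemp rEdgeRow ;; reduceMod ;;
  writeArr aRowSum rEdgeCol rTemp

/-- Remove the edge `rCursor`, push its column, and go to the next edge of its row. -/
def removeEdge : Prog :=
  readArr rEdgeRow aRow rCursor ;; readArr rEdgeCol aCol rCursor ;;
  readArr rTemp aCount rEdgeCol ;; .sub rTemp rTemp rOne ;; writeArr aCount rEdgeCol rTemp ;;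
  readArr rTemp aRowSum rEdgeCol ;; .add rTemp rTemp rAllRows ;; .sub rTemp rTemp rEdgeRow ;;
  reduceMod ;; writeArr aRowSum rEdgeCol rTemp ;;
  readArr rCursor aNext rCursor ;;
  .add rTop rTop rOne ;; writeArr aStack rTop rEdgeCol

/-- Begin to remove the row of the only edge of column `rEdgeCol`. -/
def beginRow : Prog :=
  readArr rEdgeRow aRowSum rEdgeCol ;; readArr rCursor aHead rEdgeRow ;; .sub rLeft rLeft rOne

/-- Pop a column, and if it has a single edge, begin to remove the row of that edge. -/
def popColumn : Prog :=
  readArr rEdgeCol aStack rTop ;; .sub rTop rTop rOne ;; readArr rTemp aCount rEdgeCol ;;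
  .cond rTemp (.sub rTest rTemp rOne ;; .cond rTest .skip beginRow) .skip

variable {n m B W r c x d : ℕ} {v : Vars} {g low : ℕ → ℕ} {A : ℕ → ℕ → ℕ} {Q : State → Prop}

theorem Vars.Represents.update (h : v.Represents n m B g A) (hd : d < rOne ∨ rLeft < d) (x : ℕ) :
    v.Represents n m B (Function.update g d x) A := by
  constructor
  all_goals try rw [Function.update_of_ne (by omega)]
  exacts [h.one, h.rows, h.cols, h.allRows, h.base, h.column, h.entry, h.size, h.top, h.cursor,
    h.left, h.head, h.next, h.row, h.col, h.count, h.rowSum, h.stack]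

theorem wp_addEdge (h : v.Represents n m B g A) (hintact : v.Intact (2 * n) (2 * m))
    (hr : g rEdgeRow = r) (hc : g rEdgeCol = c) (hrow : r < 2 * n) (hcol : c < 2 * m)
    (hW : 7 * (2 * n + 2 * m + v.size + 1) + B + 6 ≤ W)
    (hQ : ∀ g' A', (v.addEdge (2 * n) r c).Represents n m B g' A' →
      g' rEdgeRow = r → g' rEdgeCol = c → Q ⟨g', layout B low A'⟩) :
    addEdge.wp W Q ⟨g, layout B low A⟩ := by
  have hhead := hintact.linked.head_le r
  have hcount := hintact.tallied.count_le c
  have hsum : v.rowSum c < 2 * n := hintact.tallied.rowSum_lt (by omega) _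
  rw [Nat.card_Icc, Nat.add_sub_cancel] at hcount
  simp only [addEdge, wp_seq]
  refine wp_add h.size h.one (by omega) ?_
  refine wp_readArr (k := r) (x := v.head r) (by simp [h.base]) (by simp [hr]) (by omega)
    (by simp [h.head]) (by omega) fun _ => ?_
  refine wp_writeArr (k := v.size + 1) (x := v.head r) (by simp [h.base]) (by simp) (by omega)
    (by simp) fun _ => ?_
  refine wp_writeArr (k := r) (x := v.size + 1) (by simp [h.base]) (by simp [hr]) (by omega)
    (by simp) fun _ => ?_
  refine wp_writeArr (k := v.size + 1) (x := r) (by simp [h.base]) (by simp) (by omega)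
    (by simp [hr]) fun _ => ?_
  refine wp_writeArr (k := v.size + 1) (x := c) (by simp [h.base]) (by simp) (by omega)
    (by simp [hc]) fun _ => ?_
  refine wp_writeArr (k := v.size + 1) (x := c) (by simp [h.base]) (by simp) (by omega)
    (by simp [hc]) fun _ => ?_
  refine wp_readArr (k := c) (x := v.count c) (by simp [h.base]) (by simp [hc]) (by omega)
    (by simp [h.count]) (by omega) fun _ => ?_
  refine wp_add (x := v.count c) (y := 1) (by simp) (by simp [h.one]) (by omega) ?_
  refine wp_writeArr (k := c) (x := v.count c + 1) (by simp [h.base]) (by simp [hc]) (by omega)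
    (by simp) fun _ => ?_
  refine wp_readArr (k := c) (x := v.rowSum c) (by simp [h.base]) (by simp [hc]) (by omega)
    (by simp [h.rowSum]) (by omega) fun _ => ?_
  refine wp_add (x := v.rowSum c) (y := r) (by simp) (by simp [hr]) (by omega) ?_
  refine wp_reduceMod (N := 2 * n) (by simp [h.one]) (by simp [h.allRows]) (Function.update_self ..)
    (by omega) (by omega) fun _ => ?_
  refine wp_writeArr (k := c) (x := (v.rowSum c + r) % (2 * n)) (by simp [h.base]) (by simp [hc])
    (by omega) (by simp) fun _ => ?_
  refine hQ _ _ ?_ (by simp [hr]) (by simp [hc])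
  constructor <;> simp [Vars.addEdge, h.one, h.rows, h.cols, h.allRows, h.base, h.column, h.entry,
    h.top, h.cursor, h.left, h.head, h.next, h.row, h.col, h.count, h.rowSum, h.stack]

variable {R : Finset ℕ}

theorem wp_removeEdge (h : v.Represents n m B g A) (hpeel : v.Peeling (2 * n) (2 * m) R)
    (hcursor : 0 < v.cursor) (hW : 7 * (2 * n + 2 * m + 2 * v.size) + B + 6 ≤ W)
    (hQ : ∀ g' A', (v.removeEdge (2 * n)).Represents n m B g' A' → Q ⟨g', layout B low A'⟩) :
    removeEdge.wp W Q ⟨g, layout B low A⟩ := by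
  have hmem := hpeel.cursor_mem_Icc hcursor
  have hle := hpeel.cursor_le
  have hrow := hpeel.linked.row_lt _ hmem
  have hcol := hpeel.linked.col_lt _ hmem
  have hnext := hpeel.linked.next_lt hmem
  have hcount := (hpeel.tallied.count_le (v.col v.cursor)).trans (v.card_live_le R)
  have hsum : v.rowSum (v.col v.cursor) < 2 * n := hpeel.tallied.rowSum_lt (by omega) _
  have htop := hpeel.top_lt hcursor
  simp only [removeEdge, wp_seq]
  refine wp_readArr (k := v.cursor) (x := v.row v.cursor) (by simp [h.base]) (by simp [h.cursor])
    (by omega) (by simp [h.row]) (by omega) fun _ => ?_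
  refine wp_readArr (k := v.cursor) (x := v.col v.cursor) (by simp [h.base]) (by simp [h.cursor])
    (by omega) (by simp [h.col]) (by omega) fun _ => ?_
  refine wp_readArr (k := v.col v.cursor) (x := v.count (v.col v.cursor)) (by simp [h.base])
    (by simp) (by omega) (by simp [h.count]) (by omega) fun _ => ?_
  refine wp_sub (x := v.count (v.col v.cursor)) (y := 1) (by simp) (by simp [h.one]) ?_
  refine wp_writeArr (k := v.col v.cursor) (x := v.count (v.col v.cursor) - 1) (by simp [h.base])
    (by simp) (by omega) (by simp) fun _ => ?_
  refine wp_readArr (k := v.col v.cursor) (x := v.rowSum (v.col v.cursor)) (by simp [h.base])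
    (by simp) (by omega) (by simp [h.rowSum]) (by omega) fun _ => ?_
  refine wp_add (x := v.rowSum (v.col v.cursor)) (y := 2 * n) (by simp) (by simp [h.allRows])
    (by omega) ?_
  refine wp_sub (y := v.row v.cursor) (Function.update_self ..) (by simp) ?_
  refine wp_reduceMod (N := 2 * n) (by simp [h.one]) (by simp [h.allRows]) (Function.update_self ..)
    (by omega) (by omega) fun _ => ?_
  refine wp_writeArr (k := v.col v.cursor)
    (x := (v.rowSum (v.col v.cursor) + 2 * n - v.row v.cursor) % (2 * n)) (by simp [h.base])
    (by simp) (by omega) (by simp) fun _ => ?_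
  refine wp_readArr (k := v.cursor) (x := v.next v.cursor) (by simp [h.base]) (by simp [h.cursor])
    (by omega) (by simp [h.next]) (by omega) fun _ => ?_
  refine wp_add (x := v.top) (y := 1) (by simp [h.top]) (by simp [h.one]) (by omega) ?_
  refine wp_writeArr (k := v.top + 1) (x := v.col v.cursor) (by simp [h.base]) (by simp) (by omega)
    (by simp) fun _ => ?_
  refine hQ _ _ ?_
  constructor <;> simp [Vars.removeEdge, h.one, h.rows, h.cols, h.allRows, h.base, h.column,
    h.entry, h.size, h.left, h.head, h.next, h.row, h.col, h.count, h.rowSum, h.stack]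

theorem wp_popColumn (h : v.Represents n m B g A) (hpeel : v.Peeling (2 * n) (2 * m) R)
    (htop : 0 < v.top) (hW : 7 * (2 * n + 2 * m + 2 * v.size) + B + 6 ≤ W)
    (hQ : ∀ g' A', v.popColumn.Represents n m B g' A' → Q ⟨g', layout B low A'⟩) :
    popColumn.wp W Q ⟨g, layout B low A⟩ := by
  have hcol := hpeel.stack_lt _ (right_mem_Icc.2 htop)
  have hsize := hpeel.card_live_add_top_le
  have hcount := (hpeel.tallied.count_le (v.stack v.top)).trans (v.card_live_le R)
  have hrow_lt : ∀ e ∈ v.live R, v.row e < 2 * n := fun e he =>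
    hpeel.linked.row_lt e (mem_filter.1 he).1
  simp only [popColumn, wp_seq]
  refine wp_readArr (k := v.top) (x := v.stack v.top) h.base h.top (by omega) (by simp [h.stack])
    (by omega) fun _ => ?_
  refine wp_sub (x := v.top) (y := 1) (by simp [h.top]) (by simp [h.one]) ?_
  refine wp_readArr (k := v.stack v.top) (x := v.count (v.stack v.top)) (by simp [h.base]) (by simp)
    (by omega) (by simp [h.count]) (by omega) fun _ => ?_
  refine wp_cond (Function.update_self ..) (fun hpos => ?_) fun hzero => ?_
  · rw [wp_seq]
    refine wp_sub (x := v.count (v.stack v.top)) (y := 1) (by simp) (by simp [h.one]) ?_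
    refine wp_cond (Function.update_self ..) (fun hne => ?_) fun hone => ?_
    · refine hQ _ _ ?_
      rw [Vars.popColumn, if_neg (by omega)]
      constructor <;> simp [h.one, h.rows, h.cols, h.allRows, h.base, h.column,
        h.entry, h.size, h.cursor, h.left, h.head, h.next, h.row, h.col, h.count, h.rowSum, h.stack]
    · simp only [beginRow, wp_seq]
      obtain ⟨e, he, hsum⟩ := hpeel.tallied.eq_row_of_count_eq_one
        (j := v.stack v.top) (by omega) hrow_lt
      have he_lt := hrow_lt e (mem_filter.1 (he ▸ mem_singleton_self e)).1
      have hhead := hpeel.linked.head_le (v.row e)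
      refine wp_readArr (k := v.stack v.top) (x := v.row e) (by simp [h.base]) (by simp) (by omega)
        (by simp [h.rowSum, hsum]) (by omega) fun _ => ?_
      refine wp_readArr (k := v.row e) (x := v.head (v.row e)) (by simp [h.base]) (by simp)
        (by omega) (by simp [h.head]) (by omega) fun _ => ?_
      refine wp_sub (x := v.left) (y := 1) (by simp [h.left]) (by simp [h.one]) ?_
      refine hQ _ _ ?_
      rw [Vars.popColumn, if_pos (by omega), hsum]
      constructor <;> simp [h.one, h.rows, h.cols, h.allRows, h.base, h.column,
        h.entry, h.size, h.head, h.next, h.row, h.col, h.count, h.rowSum, h.stack]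
  · refine hQ _ _ ?_
    rw [Vars.popColumn, if_neg (by omega)]
    constructor <;> simp [h.one, h.rows, h.cols, h.allRows, h.base, h.column,
      h.entry, h.size, h.cursor, h.left, h.head, h.next, h.row, h.col, h.count, h.rowSum, h.stack]

end Representation

section PeelLoop

variable {n m B W : ℕ} {v : Vars} {R : Finset ℕ} {g low : ℕ → ℕ} {A : ℕ → ℕ → ℕ} {Q : State → Prop}

/-- Remove an edge if one is waiting to be removed, and otherwise pop a column. -/
def peelBody : Prog :=
  .cond rCursor removeEdge popColumn ;; .add rContinue rCursor rTop

theorem wp_add_cursor_top (h : v.Represents n m B g A) (hpeel : v.Peeling (2 * n) (2 * m) R)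
    (hW : 3 * v.size ≤ W)
    (hQ : ∀ g', v.Represents n m B g' A → g' rContinue = v.cursor + v.top →
      Q ⟨g', layout B low A⟩) :
    (Prog.add rContinue rCursor rTop).wp W Q ⟨g, layout B low A⟩ := by
  have hcursor := hpeel.cursor_le
  have htop := hpeel.card_live_add_top_le
  exact wp_add h.cursor h.top (by omega)
    (hQ _ (h.update (by decide) _) (Function.update_self ..))

theorem wp_peelBody (h : v.Represents n m B g A) (hpeel : v.Peeling (2 * n) (2 * m) R)
    (hpos : 0 < v.cursor + v.top) (hW : 7 * (2 * n + 2 * m + 2 * v.size) + B + 6 ≤ W)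
    (hQ : ∀ (v' : Vars) R' g' A', v'.Represents n m B g' A' → v'.Peeling (2 * n) (2 * m) R' →
      g' rContinue = v'.cursor + v'.top → v'.size = v.size →
      v'.multiplicity (2 * n) (2 * m) = v.multiplicity (2 * n) (2 * m) →
      2 * #(v'.live R') + v'.top < 2 * #(v.live R) + v.top → Q ⟨g', layout B low A'⟩) :
    peelBody.wp W Q ⟨g, layout B low A⟩ := by
  rw [peelBody, wp_seq]
  refine wp_cond h.cursor (fun hcursor => ?_) fun hcursor => ?_
  · have hpeel' := hpeel.removeEdge hcursor
    refine wp_removeEdge h hpeel hcursor hW fun g₁ A' h₁ => ?_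
    refine wp_add_cursor_top h₁ hpeel' (by rw [Vars.removeEdge_size]; omega) fun g' h' hc => ?_
    refine hQ _ _ g' A' h' hpeel' hc rfl Vars.multiplicity_removeEdge ?_
    have hcard := card_erase_add_one (hpeel.cursor_mem_live hcursor)
    rw [hpeel.live_removeEdge hcursor, Vars.removeEdge_top]
    omega
  · have htop : 0 < v.top := by omega
    obtain ⟨R', hpeel', hlive⟩ := hpeel.popColumn hcursor htop
    refine wp_popColumn h hpeel htop hW fun g₁ A' h₁ => ?_
    refine wp_add_cursor_top h₁ hpeel' (by rw [Vars.popColumn_size]; omega) fun g' h' hc => ?_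
    refine hQ _ _ g' A' h' hpeel' hc Vars.popColumn_size Vars.multiplicity_popColumn ?_
    rw [hlive, Vars.popColumn_top]
    omega

theorem exec_peelLoop (h : v.Represents n m B g A) (hpeel : v.Peeling (2 * n) (2 * m) R)
    (hcontinue : g rContinue = v.cursor + v.top)
    (hW : 7 * (2 * n + 2 * m + 2 * v.size) + B + 6 ≤ W) :
    ∃ t τ, Exec W (.loop rContinue peelBody) ⟨g, layout B low A⟩ t τ ∧
      t ≤ (peelBody.len + 1) * (3 * v.size) + 1 ∧
      (τ.reg rLeft = 0 ↔ Peelable (v.multiplicity (2 * n) (2 * m))) := by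
  let I (φ : ℕ) (σ : State) : Prop := ∃ (v' : Vars) (R' : Finset ℕ) (g' : ℕ → ℕ) (A' : ℕ → ℕ → ℕ),
    σ = ⟨g', layout B low A'⟩ ∧
    v'.Represents n m B g' A' ∧ v'.Peeling (2 * n) (2 * m) R' ∧
    g' rContinue = v'.cursor + v'.top ∧ v'.size = v.size ∧
    v'.multiplicity (2 * n) (2 * m) = v.multiplicity (2 * n) (2 * m) ∧
    2 * #(v'.live R') + v'.top = φ
  have hstep : ∀ φ σ, I φ σ → 0 < σ.reg rContinue →
      peelBody.wp W (fun τ => ∃ φ' < φ, I φ' τ) σ := by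
    rintro φ _ ⟨v', R', g', A', rfl, h', hpeel', hc, hsize, hmul, rfl⟩ hpos
    exact wp_peelBody h' hpeel' (hc ▸ hpos) (hsize ▸ hW)
      fun v₁ R₁ g₁ A₁ h₁ hpeel₁ hc₁ hsize₁ hmul₁ hlt =>
        ⟨_, hlt, v₁, R₁, g₁, A₁, rfl, h₁, hpeel₁, hc₁, hsize₁.trans hsize, hmul₁.trans hmul, rfl⟩
  obtain ⟨t, _, hexec, ht, hzero, _, v', R', g', A', rfl, h', hpeel', hc, -, hmul, -⟩ :=
    exec_loop I hstep ⟨v, R, g, A, rfl, h, hpeel, hcontinue, rfl, rfl, rfl⟩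
  refine ⟨t, _, hexec, ht.trans ?_, ?_⟩
  · have hlive := hpeel.card_live_add_top_le
    have hcard := v.card_live_le R
    gcongr
    omega
  · obtain ⟨hcursor, htop⟩ := Nat.add_eq_zero_iff.1 (hc.symm.trans hzero)
    rw [← hmul, ← hpeel'.left_eq_zero_iff hcursor htop]
    exact iff_of_eq (congrArg (· = 0) h'.left)

end PeelLoop

section Build

/-- The memory `low` holds a compressed column storage of an `n × m` matrix with `ν` entries. Rows,
columns and positions are numbered from `0` here: the entry at position `k` is in row `s k` and
column `t k`, and column `j` occupies the positions from `ptr j` up to `ptr (j + 1)`. -/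
structure Storage (n m ν : ℕ) (low ptr s t : ℕ → ℕ) : Prop where
  low_rows : low 0 = n
  low_cols : n + low 1 = m
  low_ptr : ∀ j < m, low (3 + j) = ptr (j + 1) + 1
  low_row : ∀ k < ν, low (3 + m + k) = s k + 1
  ptr_mono : Monotone ptr
  ptr_zero : ptr 0 = 0
  ptr_last : ptr m = ν
  ptr_le : ∀ j, ptr j ≤ ν
  row_lt : ∀ k < ν, s k < n
  col_lt : ∀ k < ν, t k < m
  mem_column : ∀ k < ν, k ∈ Set.Ico (ptr (t k)) (ptr (t k + 1))

theorem Storage.rows_le {n m ν : ℕ} {low ptr s t : ℕ → ℕ} (h : Storage n m ν low ptr s t) :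
    n ≤ m :=
  (Nat.le_add_right _ _).trans_eq h.low_cols

namespace Vars

/-- The variables after an entry in row `i` of the current column is added to both graphs. -/
def storeEntry (n m i : ℕ) (v : Vars) : Vars :=
  { (v.addEdge (2 * n) i v.column).addEdge (2 * n) (n + i) (m + v.column) with
    entry := v.entry + 1 }

theorem storeEntry_column (n m i : ℕ) (v : Vars) : (v.storeEntry n m i).column = v.column := rfl

theorem storeEntry_entry (n m i : ℕ) (v : Vars) : (v.storeEntry n m i).entry = v.entry + 1 := rfl

/-- The variables after the current column is completed by the edge on the diagonal, which only the
second graph has. -/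
def finishColumn (n m : ℕ) (v : Vars) : Vars :=
  { if v.column < n then v.addEdge (2 * n) (n + v.column) (m + v.column) else v with
    column := v.column + 1 }

theorem finishColumn_column (n m : ℕ) (v : Vars) : (v.finishColumn n m).column = v.column + 1 := rfl

theorem finishColumn_entry (n m : ℕ) (v : Vars) : (v.finishColumn n m).entry = v.entry := by
  rw [finishColumn]
  split_ifs <;> rfl

/-- The invariant of the loop that builds the multigraph. -/
structure Building (n m : ℕ) (ptr s t : ℕ → ℕ) (v : Vars) : Prop where
  intact : v.Intact (2 * n) (2 * m)
  column_le : v.column ≤ m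
  entry_mem : v.entry ∈ Set.Icc (ptr v.column) (ptr (v.column + 1))
  sum_eq : ∀ F : ℕ → ℕ → ℕ, ∑ e ∈ Icc 1 v.size, F (v.row e) (v.col e) =
    ∑ k ∈ range v.entry, (F (s k) (t k) + F (n + s k) (m + t k)) +
      ∑ j ∈ range v.column, if j < n then F (n + j) (m + j) else 0

variable {n m ν : ℕ} {low ptr s t : ℕ → ℕ} {v : Vars}

namespace Building

theorem col_entry_eq (h : v.Building n m ptr s t) (hstorage : Storage n m ν low ptr s t)
    (hlt : v.entry < ptr (v.column + 1)) : t v.entry = v.column :=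
  eq_of_mem_Ico_apply_succ hstorage.ptr_mono
    (hstorage.mem_column _ (hlt.trans_le (hstorage.ptr_le _))) ⟨h.entry_mem.1, hlt⟩

theorem storeEntry (h : v.Building n m ptr s t) (hstorage : Storage n m ν low ptr s t)
    (hlt : v.entry < ptr (v.column + 1)) :
    (v.storeEntry n m (s v.entry)).Building n m ptr s t := by
  have hν := hlt.trans_le (hstorage.ptr_le _)
  have hcol := h.col_entry_eq hstorage hlt
  have hrow_lt := hstorage.row_lt _ hν
  have hcol_lt := hcol ▸ hstorage.col_lt _ hν
  have hintact := (h.intact.addEdge (r := s v.entry) (c := v.column) (by omega) (by omega)).addEdge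
    (r := n + s v.entry) (c := m + v.column) (by omega) (by omega)
  refine ⟨hintact.with_positions _ _ _, h.column_le, ⟨h.entry_mem.1.trans (Nat.le_succ _), hlt⟩,
    fun F => ?_⟩
  refine (sum_addEdge (N := 2 * n) F).trans ?_
  rw [sum_addEdge, h.sum_eq]
  simp only [Vars.storeEntry, addEdge_column, sum_range_succ, hcol]
  ring

theorem finishColumn (h : v.Building n m ptr s t) (hstorage : Storage n m ν low ptr s t)
    (hle : ptr (v.column + 1) ≤ v.entry) (hlt : v.column < m) :
    (v.finishColumn n m).Building n m ptr s t := by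
  have hmem : v.entry ∈ Set.Icc (ptr (v.column + 1)) (ptr (v.column + 1 + 1)) :=
    ⟨hle, h.entry_mem.2.trans (hstorage.ptr_mono (Nat.le_succ _))⟩
  rw [Vars.finishColumn]
  split_ifs with hn
  · have hintact := h.intact.addEdge (r := n + v.column) (c := m + v.column) (by omega) (by omega)
    refine ⟨hintact.with_positions _ _ _, hlt, hmem, fun F => ?_⟩
    refine (sum_addEdge (N := 2 * n) F).trans ?_
    rw [h.sum_eq, sum_range_succ _ v.column, if_pos hn, add_assoc]
    rfl
  · refine ⟨h.intact.with_positions _ _ _, hlt, hmem, fun F => ?_⟩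
    rw [h.sum_eq, sum_range_succ _ v.column, if_neg hn, add_zero]

theorem size_le (h : v.Building n m ptr s t) : v.size ≤ 2 * v.entry + v.column := by
  have hsize := h.sum_eq fun _ _ => 1
  rw [sum_const, Nat.card_Icc, sum_const, card_range, sum_boole] at hsize
  have hdiagonal := (card_filter_le (range v.column) (· < n)).trans_eq (card_range _)
  simp only [smul_eq_mul] at hsize
  push_cast at hsize
  omega

theorem entry_le (h : v.Building n m ptr s t) (hstorage : Storage n m ν low ptr s t) :
    v.entry ≤ ν :=
  h.entry_mem.2.trans (hstorage.ptr_le _)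

theorem entry_eq (h : v.Building n m ptr s t) (hstorage : Storage n m ν low ptr s t)
    (hcolumn : v.column = m) : v.entry = ν :=
  (h.entry_le hstorage).antisymm (hstorage.ptr_last ▸ hcolumn ▸ h.entry_mem.1)

end Building

end Vars

end Build

section BuildLoop

/-- Store the number of the remaining entries of the current column in `rTemp`. -/
def countRemaining : Prog :=
  .const rAddress 3 ;; .add rAddress rAddress rColumn ;; .load rTemp rAddress ;;
  .sub rTemp rTemp rEntry ;; .sub rTemp rTemp rOne

/-- Add the next entry of the current column to both graphs. -/
def storeEntry : Prog :=
  .const rAddress 3 ;; .add rAddress rAddress rCols ;; .add rAddress rAddress rEntry ;;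
  .load rEdgeRow rAddress ;; .sub rEdgeRow rEdgeRow rOne ;; .copy rEdgeCol rColumn ;; addEdge ;;
  .add rEdgeRow rRows rEdgeRow ;; .add rEdgeCol rCols rEdgeCol ;; addEdge ;;
  .add rEntry rEntry rOne

/-- Add the edge on the diagonal of the second graph, and go to the next column. -/
def finishColumn : Prog :=
  .sub rTemp rRows rColumn ;;
  .cond rTemp (.add rEdgeRow rRows rColumn ;; .add rEdgeCol rCols rColumn ;; addEdge) .skip ;;
  .add rColumn rColumn rOne

/-- Store an entry if the current column has one left, and otherwise finish the column. -/
def buildBody : Prog :=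
  countRemaining ;; .cond rTemp storeEntry finishColumn ;; .sub rContinue rCols rColumn

variable {n m ν B W : ℕ} {v : Vars} {g low ptr s t : ℕ → ℕ} {A : ℕ → ℕ → ℕ} {Q : State → Prop}

theorem wp_countRemaining (h : v.Represents n m (3 + m + ν) g A)
    (hstorage : Storage n m ν low ptr s t) (hlt : v.column < m) (hW : 3 + m + ν ≤ W)
    (hQ : ∀ g', v.Represents n m (3 + m + ν) g' A → g' rTemp = ptr (v.column + 1) - v.entry →
      Q ⟨g', layout (3 + m + ν) low A⟩) :
    countRemaining.wp W Q ⟨g, layout (3 + m + ν) low A⟩ := by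
  have hptr_le := hstorage.ptr_le (v.column + 1)
  have hptr : layout (3 + m + ν) low A (3 + v.column) = ptr (v.column + 1) + 1 :=
    (layout_of_lt low A (by omega)).trans (hstorage.low_ptr _ hlt)
  have hremaining : ptr (v.column + 1) + 1 - v.entry - 1 = ptr (v.column + 1) - v.entry := by omega
  simp only [countRemaining, wp_seq]
  refine wp_const (by omega) ?_
  refine wp_add (x := 3) (y := v.column) (by simp) (by simp [h.column]) (by omega) ?_
  refine wp_load (Function.update_self ..) hptr (by omega) ?_
  refine wp_sub (y := v.entry) (Function.update_self ..) (by simp [h.entry]) ?_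
  refine wp_sub (y := 1) (Function.update_self ..) (by simp [h.one]) ?_
  refine hQ _ ?_ (by simp [hremaining])
  iterate 5 refine Vars.Represents.update ?_ (by decide) _
  exact h

theorem wp_storeEntry (h : v.Represents n m (3 + m + ν) g A) (hbuild : v.Building n m ptr s t)
    (hstorage : Storage n m ν low ptr s t) (hlt : v.entry < ptr (v.column + 1))
    (hW : 43 * (m + ν) + 16 ≤ W)
    (hQ : ∀ g' A', (v.storeEntry n m (s v.entry)).Represents n m (3 + m + ν) g' A' →
      Q ⟨g', layout (3 + m + ν) low A'⟩) :
    storeEntry.wp W Q ⟨g, layout (3 + m + ν) low A⟩ := by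
  have hν := hlt.trans_le (hstorage.ptr_le _)
  have hcol := hbuild.col_entry_eq hstorage hlt ▸ hstorage.col_lt _ hν
  have hrow := hstorage.row_lt _ hν
  have hle := hstorage.rows_le
  have hsize := hbuild.size_le
  have hcell : layout (3 + m + ν) low A (3 + m + v.entry) = s v.entry + 1 :=
    (layout_of_lt low A (by omega)).trans (hstorage.low_row _ hν)
  simp only [storeEntry, wp_seq]
  refine wp_const (by omega) ?_
  refine wp_add (x := 3) (y := m) (by simp) (by simp [h.cols]) (by omega) ?_
  refine wp_add (x := 3 + m) (y := v.entry) (by simp) (by simp [h.entry]) (by omega) ?_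
  refine wp_load (Function.update_self ..) hcell (by omega) ?_
  refine wp_sub (y := 1) (Function.update_self ..) (by simp [h.one]) ?_
  refine wp_copy (x := v.column) (by simp [h.column]) ?_
  refine wp_addEdge (r := s v.entry) (c := v.column) (v := v) ?_ hbuild.intact (by simp) (by simp)
    (by omega) (by omega) (by omega) fun g₁ A₁ h₁ hr hc => ?_
  · iterate 6 refine Vars.Represents.update ?_ (by decide) _
    exact h
  refine wp_add h₁.rows hr (by omega) ?_
  refine wp_add (x := m) (y := v.column) (by simp [h₁.cols]) (by simp [hc]) (by omega) ?_
  refine wp_addEdge (r := n + s v.entry) (c := m + v.column)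
    ((h₁.update (by decide) _).update (by decide) _)
    (hbuild.intact.addEdge (by omega) (by omega)) (by simp) (by simp) (by omega) (by omega)
    (by rw [Vars.addEdge_size]; omega) fun g₂ A₂ h₂ _ _ => ?_
  refine wp_add h₂.entry h₂.one (by rw [Vars.addEdge_entry, Vars.addEdge_entry]; omega) ?_
  refine hQ _ _ ?_
  constructor <;> simp [Vars.storeEntry, h₂.one, h₂.rows, h₂.cols, h₂.allRows, h₂.base, h₂.column,
    h₂.size, h₂.top, h₂.cursor, h₂.left, h₂.head, h₂.next, h₂.row, h₂.col, h₂.count, h₂.rowSum,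
    h₂.stack]

theorem wp_finishColumn (h : v.Represents n m (3 + m + ν) g A) (hbuild : v.Building n m ptr s t)
    (hstorage : Storage n m ν low ptr s t) (hlt : v.column < m) (hW : 43 * (m + ν) + 16 ≤ W)
    (hQ : ∀ g' A', (v.finishColumn n m).Represents n m (3 + m + ν) g' A' →
      Q ⟨g', layout (3 + m + ν) low A'⟩) :
    finishColumn.wp W Q ⟨g, layout (3 + m + ν) low A⟩ := by
  have hentry := hbuild.entry_le hstorage
  have hle := hstorage.rows_le
  have hsize := hbuild.size_le
  simp only [finishColumn, wp_seq]
  refine wp_sub h.rows h.column ?_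
  refine wp_cond (Function.update_self ..) (fun hpos => ?_) fun hzero => ?_
  · simp only [wp_seq]
    refine wp_add (x := n) (y := v.column) (by simp [h.rows]) (by simp [h.column]) (by omega) ?_
    refine wp_add (x := m) (y := v.column) (by simp [h.cols]) (by simp [h.column]) (by omega) ?_
    refine wp_addEdge (r := n + v.column) (c := m + v.column) (v := v) ?_ hbuild.intact (by simp)
      (by simp) (by omega) (by omega) (by omega) fun g₁ A₁ h₁ _ _ => ?_
    · iterate 3 refine Vars.Represents.update ?_ (by decide) _
      exact h
    refine wp_add h₁.column h₁.one (by rw [Vars.addEdge_column]; omega) ?_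
    refine hQ _ _ ?_
    rw [Vars.finishColumn, if_pos (by omega)]
    constructor <;> simp [h₁.one, h₁.rows, h₁.cols, h₁.allRows, h₁.base, h₁.entry, h₁.size, h₁.top,
      h₁.cursor, h₁.left, h₁.head, h₁.next, h₁.row, h₁.col, h₁.count, h₁.rowSum, h₁.stack]
  · refine wp_add (x := v.column) (y := 1) (by simp [h.column]) (by simp [h.one]) (by omega) ?_
    refine hQ _ _ ?_
    rw [Vars.finishColumn, if_neg (by omega)]
    constructor <;> simp [h.one, h.rows, h.cols, h.allRows, h.base, h.entry, h.size, h.top,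
      h.cursor, h.left, h.head, h.next, h.row, h.col, h.count, h.rowSum, h.stack]

theorem wp_buildBody (h : v.Represents n m (3 + m + ν) g A) (hbuild : v.Building n m ptr s t)
    (hstorage : Storage n m ν low ptr s t) (hlt : v.column < m) (hW : 43 * (m + ν) + 16 ≤ W)
    (hQ : ∀ (v' : Vars) g' A', v'.Represents n m (3 + m + ν) g' A' → v'.Building n m ptr s t →
      g' rContinue = m - v'.column →
      ν - v'.entry + (m - v'.column) < ν - v.entry + (m - v.column) →
      Q ⟨g', layout (3 + m + ν) low A'⟩) :
    buildBody.wp W Q ⟨g, layout (3 + m + ν) low A⟩ := by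
  have hptr_le := hstorage.ptr_le (v.column + 1)
  have hcontinue (v' : Vars) (g₁ : ℕ → ℕ) (A' : ℕ → ℕ → ℕ)
      (h₁ : v'.Represents n m (3 + m + ν) g₁ A') (hbuild' : v'.Building n m ptr s t)
      (hφ : ν - v'.entry + (m - v'.column) < ν - v.entry + (m - v.column)) :
      (Prog.sub rContinue rCols rColumn).wp W Q ⟨g₁, layout (3 + m + ν) low A'⟩ :=
    wp_sub h₁.cols h₁.column
      (hQ v' _ A' (h₁.update (by decide) _) hbuild' (Function.update_self ..) hφ)
  simp only [buildBody, wp_seq]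
  refine wp_countRemaining h hstorage hlt (by omega) fun g₀ h₀ hremaining => ?_
  refine wp_cond hremaining (fun hpos => ?_) fun hzero => ?_
  · have hentry : v.entry < ptr (v.column + 1) := by omega
    refine wp_storeEntry h₀ hbuild hstorage hentry hW fun g₁ A' h₁ => ?_
    refine hcontinue _ g₁ A' h₁ (hbuild.storeEntry hstorage hentry) ?_
    rw [Vars.storeEntry_entry, Vars.storeEntry_column]
    omega
  · refine wp_finishColumn h₀ hbuild hstorage hlt hW fun g₁ A' h₁ => ?_
    refine hcontinue _ g₁ A' h₁ (hbuild.finishColumn hstorage (by omega) hlt) ?_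
    rw [Vars.finishColumn_entry, Vars.finishColumn_column]
    omega

theorem exec_buildLoop (h : v.Represents n m (3 + m + ν) g A) (hbuild : v.Building n m ptr s t)
    (hstorage : Storage n m ν low ptr s t) (hcontinue : g rContinue = m - v.column)
    (hW : 43 * (m + ν) + 16 ≤ W) :
    ∃ k τ, Exec W (.loop rContinue buildBody) ⟨g, layout (3 + m + ν) low A⟩ k τ ∧
      k ≤ (buildBody.len + 1) * (ν + m) + 1 ∧
      ∃ (v' : Vars) (g' : ℕ → ℕ) (A' : ℕ → ℕ → ℕ), τ = ⟨g', layout (3 + m + ν) low A'⟩ ∧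
        v'.Represents n m (3 + m + ν) g' A' ∧ v'.Building n m ptr s t ∧ v'.column = m := by
  let I (φ : ℕ) (σ : State) : Prop := ∃ (v' : Vars) (g' : ℕ → ℕ) (A' : ℕ → ℕ → ℕ),
    σ = ⟨g', layout (3 + m + ν) low A'⟩ ∧ v'.Represents n m (3 + m + ν) g' A' ∧
    v'.Building n m ptr s t ∧ g' rContinue = m - v'.column ∧ ν - v'.entry + (m - v'.column) = φ
  have hstep : ∀ φ σ, I φ σ → 0 < σ.reg rContinue →
      buildBody.wp W (fun τ => ∃ φ' < φ, I φ' τ) σ := by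
    rintro φ _ ⟨v', g', A', rfl, h', hbuild', hc, rfl⟩ hpos
    exact wp_buildBody h' hbuild' hstorage (Nat.lt_of_sub_pos (hc ▸ hpos)) hW
      fun v₁ g₁ A₁ h₁ hbuild₁ hc₁ hlt => ⟨_, hlt, v₁, g₁, A₁, rfl, h₁, hbuild₁, hc₁, rfl⟩
  obtain ⟨k, _, hexec, hk, hzero, _, v', g', A', rfl, h', hbuild', hc, -⟩ :=
    exec_loop I hstep ⟨v, g, A, rfl, h, hbuild, hcontinue, rfl⟩
  refine ⟨k, _, hexec, hk.trans ?_, v', g', A', rfl, h', hbuild', hbuild'.column_le.antisymm ?_⟩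
  · gcongr <;> omega
  · exact Nat.le_of_sub_eq_zero (hc.symm.trans hzero)

end BuildLoop

section Program

theorem Storage.low_last {n m ν : ℕ} {low ptr s t : ℕ → ℕ} (h : Storage n m ν low ptr s t)
    (hm : 0 < m) : low (m + 2) = ν + 1 := by
  obtain ⟨j, rfl⟩ := Nat.exists_eq_succ_of_ne_zero hm.ne'
  rw [← h.ptr_last, ← h.low_ptr j j.lt_succ_self, Nat.add_comm]
  congr 1
  omega

namespace Vars

/-- The multigraph with `N` rows and without edges. -/
def empty (N : ℕ) : Vars where
  column := 0
  entry := 0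
  size := 0
  top := 0
  cursor := 0
  left := N
  head := 0
  next := 0
  row := 0
  col := 0
  count := 0
  rowSum := 0
  stack := 0

theorem intact_empty (N M : ℕ) : (empty N).Intact N M where
  linked := ⟨by simp [empty], by simp [empty], fun _ => rfl, by simp [empty]⟩
  tallied := ⟨fun _ => rfl, fun _ => (Nat.zero_mod N).symm⟩
  stack_eq := by simp [empty]
  cursor_eq := rfl
  left_eq := rfl

theorem building_empty {n m ν : ℕ} {low ptr s t : ℕ → ℕ} (hstorage : Storage n m ν low ptr s t) :
    (empty (2 * n)).Building n m ptr s t where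
  intact := intact_empty _ _
  column_le := Nat.zero_le _
  entry_mem := ⟨hstorage.ptr_zero.le, Nat.zero_le _⟩
  sum_eq _ := rfl

end Vars

/-- Read the sizes of the system, and begin with a multigraph without edges. -/
def setup : Prog :=
  .const rOne 1 ;; .load rRows rOutput ;; .load rCols rOne ;; .add rCols rRows rCols ;;
  .add rAllRows rRows rRows ;; .copy rLeft rAllRows ;;
  .const rAddress 2 ;; .add rAddress rCols rAddress ;; .load rBase rAddress ;;
  .add rBase rBase rAddress ;; .copy rContinue rCols

/-- Put all columns with edges on the stack. -/
def fillStack : Prog := .copy rTop rSize ;; .copy rContinue rSize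

/-- Output whether no row is left. -/
def output : Prog := .cond rLeft (.const rOutput 0) (.const rOutput 1)

/-- The program builds the multigraph from the compressed column storage, and then removes rows as
long as there is a column with a single edge. -/
def program : Prog :=
  setup ;; .loop rContinue buildBody ;; fillStack ;; .loop rContinue peelBody ;; output

/-- The running time of `program` on a matrix with `m` columns and `ν` entries is at most
`timeFactor * (m + ν)`: the loop bodies are executed at most `m + ν` and `6 * (m + ν)` times. -/
def timeFactor : ℕ := setup.len + fillStack.len + output.len + buildBody.len + 6 * peelBody.len + 9

variable {n m ν B W : ℕ} {v : Vars} {g low ptr s t : ℕ → ℕ} {A : ℕ → ℕ → ℕ} {Q : State → Prop}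

theorem wp_setup (hstorage : Storage n m ν low ptr s t) (hm : 0 < m) (hW : 3 + 2 * m + ν ≤ W)
    (hQ : ∀ g', (Vars.empty (2 * n)).Represents n m (3 + m + ν) g' 0 → g' rContinue = m →
      Q ⟨g', low⟩) :
    setup.wp W Q ⟨0, low⟩ := by
  have hle := hstorage.rows_le
  have hcols := hstorage.low_cols
  have hbase : ν + 1 + (m + 2) = 3 + m + ν := by omega
  simp only [setup, wp_seq]
  refine wp_const (by omega) ?_
  refine wp_load (k := 0) (by simp) hstorage.low_rows (by omega) ?_
  refine wp_load (k := 1) (x := low 1) (by simp) rfl (by omega) ?_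
  refine wp_add (x := n) (y := low 1) (by simp) (by simp) (by omega) ?_
  refine wp_add (x := n) (y := n) (by simp) (by simp) (by omega) ?_
  refine wp_copy (x := n + n) (by simp) ?_
  refine wp_const (by omega) ?_
  refine wp_add (x := m) (y := 2) (by simp [hcols]) (by simp) (by omega) ?_
  refine wp_load (k := m + 2) (by simp) (hstorage.low_last hm) (by omega) ?_
  refine wp_add (x := ν + 1) (y := m + 2) (by simp) (by simp) (by omega) ?_
  refine wp_copy (x := m) (by simp [hcols]) ?_
  refine hQ _ ?_ (by simp)
  constructor <;> simp [Vars.empty, hcols, two_mul, hbase]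

theorem exec_peel (h : v.Represents n m B g A) (hintact : v.Intact (2 * n) (2 * m))
    (hW : 7 * (2 * n + 2 * m + 2 * v.size) + B + 6 ≤ W) :
    ∃ k τ, Exec W (fillStack ;; .loop rContinue peelBody ;; output) ⟨g, layout B low A⟩ k τ ∧
      k ≤ fillStack.len + ((peelBody.len + 1) * (3 * v.size) + 1 + output.len) ∧
      (τ.reg rOutput = 0 ∨ τ.reg rOutput = 1) ∧
      (τ.reg rOutput = 1 ↔ Peelable (v.multiplicity (2 * n) (2 * m))) := by
  refine exec_seq_of_wp ?_
  rw [fillStack, wp_seq]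
  refine wp_copy h.size (wp_copy (x := v.size) (by simp [h.size]) ?_)
  set g' := Function.update (Function.update g rTop v.size) rContinue v.size with hg'
  have h' : Vars.Represents n m B g' A { v with top := v.size } := by
    constructor <;> simp [hg', h.one, h.rows, h.cols, h.allRows, h.base, h.column, h.entry, h.size,
      h.cursor, h.left, h.head, h.next, h.row, h.col, h.count, h.rowSum, h.stack]
  have hpeel := (hintact.with_positions v.column v.entry v.size).peeling rfl
  have hcontinue : g' rContinue = v.cursor + v.size := by simp [hg', hintact.cursor_eq]
  obtain ⟨k, τ, hloop, hk, hleft⟩ := exec_peelLoop (low := low) h' hpeel hcontinue hW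
  have houtput : output.wp W (fun ρ => (ρ.reg rOutput = 0 ∨ ρ.reg rOutput = 1) ∧
      (ρ.reg rOutput = 1 ↔ τ.reg rLeft = 0)) τ := by
    refine wp_cond rfl (fun hpos => wp_const (by omega) ?_) fun hzero => wp_const (by omega) ?_
    · simp [hpos.ne']
    · simp [hzero]
  obtain ⟨k', ρ, hexec, hk', hbool, hiff⟩ := Prog.exec_of_wp houtput
  exact ⟨_, ρ, .seq _ _ _ _ _ _ _ hloop hexec, Nat.add_le_add hk hk', hbool, hiff.trans hleft⟩

theorem exec_program (hstorage : Storage n m ν low ptr s t) (hlow : ∀ a, 3 + m + ν ≤ a → low a = 0)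
    (hm : 0 < m) (hW : 59 * (m + ν) ≤ W) :
    ∃ k τ, Exec W program ⟨0, low⟩ k τ ∧
      k ≤ timeFactor * (m + ν) ∧
      (τ.reg rOutput = 0 ∨ τ.reg rOutput = 1) ∧
      ∃ v : Vars, v.Building n m ptr s t ∧ v.column = m ∧
        (τ.reg rOutput = 1 ↔ Peelable (v.multiplicity (2 * n) (2 * m))) := by
  have hle := hstorage.rows_le
  suffices h : ∃ k τ, Exec W program ⟨0, low⟩ k τ ∧
      k ≤ setup.len + ((buildBody.len + 1) * (ν + m) + 1 + (fillStack.len +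
        ((peelBody.len + 1) * (3 * (2 * ν + m)) + 1 + output.len))) ∧
      (τ.reg rOutput = 0 ∨ τ.reg rOutput = 1) ∧
      ∃ v : Vars, v.Building n m ptr s t ∧ v.column = m ∧
        (τ.reg rOutput = 1 ↔ Peelable (v.multiplicity (2 * n) (2 * m))) by
    obtain ⟨k, τ, hexec, hk, h⟩ := h
    refine ⟨k, τ, hexec, hk.trans ?_, h⟩
    rw [timeFactor]
    nlinarith
  refine exec_seq_of_wp ?_
  refine wp_setup hstorage hm (by omega) fun g h hcontinue => ?_
  rw [← layout_zero hlow]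
  obtain ⟨k, _, hexec, hk, v, g', A', rfl, h', hbuild, hcolumn⟩ :=
    exec_buildLoop (W := W) h (Vars.building_empty hstorage) hstorage hcontinue (by omega)
  have hsize := hbuild.size_le
  rw [hcolumn, hbuild.entry_eq hstorage hcolumn] at hsize
  obtain ⟨k', ρ, hexec', hk', hbool, hiff⟩ := exec_peel (low := low) (W := W) h' hbuild.intact
    (by omega)
  refine ⟨_, ρ, .seq _ _ _ _ _ _ _ hexec hexec', Nat.add_le_add hk (hk'.trans ?_), hbool, v,
    hbuild, hcolumn, hiff⟩
  gcongr

end Program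

end RAM

section Correctness

open Finset

theorem sum_peelWeight_zero_mul {n m : ℕ} (𝒳 : StructMatrix n m) (F : ℕ → ℕ → ℕ) :
    ∑ i : Fin n, ∑ j : Fin m, peelWeight 0 𝒳 i j * F i j =
      ∑ p : {p : Fin n × Fin m // 𝒳 p.1 p.2 = true}, F p.1.1 p.1.2 := by
  rw [← sum_subtype {p : Fin n × Fin m | 𝒳 p.1 p.2 = true} (fun p => mem_filter_univ p)
    fun p => F p.1 p.2, sum_filter, Fintype.sum_prod_type]
  simp [peelWeight]

theorem sum_peelWeight_one_mul {n m : ℕ} (𝒳 : StructMatrix n m) (F : ℕ → ℕ → ℕ) :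
    ∑ i : Fin n, ∑ j : Fin m, peelWeight 1 𝒳 i j * F i j =
      ∑ i : Fin n, ∑ j : Fin m, peelWeight 0 𝒳 i j * F i j +
        ∑ j ∈ range m, if j < n then F j j else 0 := by
  have hdiagonal (j : ℕ) :
      (∑ i : Fin n, if (i : ℕ) = j then F i j else 0) = if j < n then F j j else 0 := by
    rw [Fin.sum_univ_eq_sum_range fun i => if i = j then F i j else 0, sum_ite_eq']
    simp only [mem_range]
  rw [← Fin.sum_univ_eq_sum_range fun j => if j < n then F j j else 0]
  simp only [← hdiagonal]
  rw [sum_comm (s := univ (α := Fin m)), ← sum_add_distrib]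
  simp [peelWeight, ← sum_add_distrib, add_mul]

section Input

variable {n r : ℕ} {𝒳 : StructMatrix n (n + r)} {colPtr rowIdx : List ℕ}

theorem IsCCS.mem_init_ptr (h : IsCCS 𝒳 colPtr rowIdx) {j : ℕ} (hj : j ≤ n + r) :
    (RAM.State.init ([n, r] ++ colPtr ++ rowIdx)).mem (j + 2) = starsBefore 𝒳 j + 1 := by
  refine (List.getD_append colPtr rowIdx 0 j (by rw [h.1]; omega)).trans ?_
  rw [List.getD_eq_getElem?_getD, h.2.2.1 j hj, Option.getD_some]

theorem IsCCS.mem_init_row (h : IsCCS 𝒳 colPtr rowIdx) (k : ℕ) :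
    (RAM.State.init ([n, r] ++ colPtr ++ rowIdx)).mem (n + r + 1 + k + 2) = rowIdx.getD k 0 := by
  refine (List.getD_append_right colPtr rowIdx 0 _ (by rw [h.1]; omega)).trans ?_
  rw [h.1, Nat.add_sub_cancel_left]

theorem IsCCS.mem_init_eq_zero (h : IsCCS 𝒳 colPtr rowIdx) {a : ℕ}
    (ha : 3 + (n + r) + numStars 𝒳 ≤ a) :
    (RAM.State.init ([n, r] ++ colPtr ++ rowIdx)).mem a = 0 := by
  refine List.getD_eq_default _ _ ?_
  rw [List.length_append, List.length_append, h.1, h.2.1, List.length_cons, List.length_singleton]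
  omega

theorem IsCCS.exists_storage (h : IsCCS 𝒳 colPtr rowIdx) :
    ∃ s t : ℕ → ℕ, RAM.Storage n (n + r) (numStars 𝒳)
        (RAM.State.init ([n, r] ++ colPtr ++ rowIdx)).mem (starsBefore 𝒳) s t ∧
      ∀ F : ℕ → ℕ → ℕ, ∑ k ∈ range (numStars 𝒳), F (s k) (t k) =
        ∑ i : Fin n, ∑ j : Fin (n + r), peelWeight 0 𝒳 i j * F i j := by
  obtain ⟨e, he⟩ := h.exists_equiv
  let s : ℕ → ℕ := Function.extend Fin.val (fun k => ((e k).1.1 : ℕ)) 0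
  let t : ℕ → ℕ := Function.extend Fin.val (fun k => ((e k).1.2 : ℕ)) 0
  have hs (k : Fin (numStars 𝒳)) : s k = (e k).1.1 := Fin.val_injective.extend_apply ..
  have ht (k : Fin (numStars 𝒳)) : t k = (e k).1.2 := Fin.val_injective.extend_apply ..
  refine ⟨s, t, ⟨rfl, rfl, fun j hj => ?_, fun k hk => ?_, starsBefore_mono 𝒳, starsBefore_zero 𝒳,
    starsBefore_eq_numStars 𝒳, fun j => card_le_card (monotone_filter_right _ fun _ _ hp => hp.2),
    fun k hk => (hs ⟨k, hk⟩).trans_lt (Fin.is_lt _),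
    fun k hk => (ht ⟨k, hk⟩).trans_lt (Fin.is_lt _),
    fun k hk => ht ⟨k, hk⟩ ▸ (he ⟨k, hk⟩).2⟩, fun F => ?_⟩
  · rw [← h.mem_init_ptr hj]
    congr 1
    omega
  · rw [hs ⟨k, hk⟩, ← Option.getD_some (a := _ + 1) (b := 0), ← (he ⟨k, hk⟩).1,
      ← List.getD_eq_getElem?_getD, ← h.mem_init_row k]
    congr 1
    omega
  · rw [sum_peelWeight_zero_mul, ← e.sum_comp fun p => F p.1.1 p.1.2,
      ← Fin.sum_univ_eq_sum_range fun k => F (s k) (t k)]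
    simp only [hs, ht]

end Input

/-- The indices of two copies of `Fin n` side by side. -/
def finSumFinTwoMul (n : ℕ) : Fin n ⊕ Fin n ≃ Fin (2 * n) :=
  finSumFinEquiv.trans (finCongr (two_mul n).symm)

theorem RAM.Vars.Building.submatrix_multiplicity {n m : ℕ} {𝒳 : StructMatrix n m}
    {ptr s t : ℕ → ℕ} {v : RAM.Vars} (hbuild : v.Building n m ptr s t) (hcolumn : v.column = m)
    (hsum : ∀ F : ℕ → ℕ → ℕ, ∑ k ∈ range v.entry, F (s k) (t k) =
        ∑ i : Fin n, ∑ j : Fin m, peelWeight 0 𝒳 i j * F i j) :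
    (v.multiplicity (2 * n) (2 * m)).submatrix (finSumFinTwoMul n) (finSumFinTwoMul m) =
      Matrix.fromBlocks (peelWeight 0 𝒳) 0 0 (peelWeight 1 𝒳) := by
  have hmul (a : Fin (2 * n)) (b : Fin (2 * m)) : v.multiplicity (2 * n) (2 * m) a b =
      ∑ i : Fin n, ∑ j : Fin m,
        peelWeight 0 𝒳 i j * (if (i : ℕ) = a ∧ (j : ℕ) = b then 1 else 0) +
      ∑ i : Fin n, ∑ j : Fin m,
        peelWeight 1 𝒳 i j * (if n + (i : ℕ) = a ∧ m + (j : ℕ) = b then 1 else 0) := by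
    rw [sum_peelWeight_one_mul 𝒳 fun i j => if n + i = a ∧ m + j = b then 1 else 0,
      ← hsum fun i j => if i = a ∧ j = b then 1 else 0,
      ← hsum fun i j => if n + i = a ∧ m + j = b then 1 else 0, ← add_assoc, ← sum_add_distrib,
      RAM.Vars.multiplicity, Matrix.of_apply, card_filter,
      hbuild.sum_eq fun i j => if i = a ∧ j = b then 1 else 0, hcolumn]
  have hinl (k : ℕ) (x : Fin k) : (finSumFinTwoMul k (.inl x) : ℕ) = x := rfl
  have hinr (k : ℕ) (x : Fin k) : (finSumFinTwoMul k (.inr x) : ℕ) = k + x := rfl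
  have hne (k : ℕ) (x y : Fin k) : k + (x : ℕ) ≠ y := by omega
  ext (i | i) (j | j) <;> rw [Matrix.submatrix_apply, hmul] <;>
    simp [hinl, hinr, hne, (hne _ _ _).symm, Fin.val_inj, ite_and]

theorem RAM.exec_program_of_isCCS {n r : ℕ} {𝒳 : StructMatrix n (n + r)} {colPtr rowIdx : List ℕ}
    {W : ℕ} (h : IsCCS 𝒳 colPtr rowIdx) (hn : 0 < n) (hW : 59 * (n + r + numStars 𝒳) ≤ W) :
    ∃ (k : ℕ) (σ : RAM.State),
      RAM.Exec W RAM.program (RAM.State.init ([n, r] ++ colPtr ++ rowIdx)) k σ ∧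
      k ≤ RAM.timeFactor * (n + r + numStars 𝒳) ∧
      (σ.reg 0 = 0 ∨ σ.reg 0 = 1) ∧
      (σ.reg 0 = 1 ↔ Peelable (peelWeight 0 𝒳) ∧ Peelable (peelWeight 1 𝒳)) := by
  obtain ⟨s, t, hstorage, hsum⟩ := h.exists_storage
  obtain ⟨k, σ, hexec, htime, hbool, v, hbuild, hcolumn, hiff⟩ :=
    RAM.exec_program hstorage (fun _ ha => h.mem_init_eq_zero ha) (Nat.add_pos_left hn r) hW
  refine ⟨k, σ, hexec, htime, hbool, hiff.trans ?_⟩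
  rw [← peelable_submatrix_equiv (finSumFinTwoMul n) (finSumFinTwoMul (n + r)),
    hbuild.submatrix_multiplicity hcolumn (hbuild.entry_eq hstorage hcolumn ▸ hsum),
    peelable_fromBlocks_zero]

end Correctness

/-- There are one program `P` and one constant `C` such that, for every pair `(𝒜, ℬ)` with `ν`
`∗`-entries, given as `n`, `r` and any compressed column storage of `(𝒜, ℬ)`, the program halts
within `C (n + r + ν)` steps, using words that hold the numbers up to `C (n + r + ν)`, and its
output, in register `0`, is `1` if `(𝒜, ℬ)` is strong structurally controllable and `0` if not
(over the reals as well as over the complex numbers). -/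
theorem mainTheorem1 :
    ∃ (P : RAM.Prog) (C : ℕ),
      ∀ (n r ν : ℕ) (𝒜 : StructMatrix n n) (ℬ : StructMatrix n r) (colPtr rowIdx : List ℕ),
        1 ≤ n →
        numStars (pairMatrix 𝒜 ℬ) = ν →
        IsCCS (pairMatrix 𝒜 ℬ) colPtr rowIdx →
        ∃ (t : ℕ) (σ : RAM.State),
          RAM.Exec (C * (n + r + ν)) P (RAM.State.init ([n, r] ++ colPtr ++ rowIdx)) t σ ∧
          t ≤ C * (n + r + ν) ∧
          (σ.reg 0 = 0 ∨ σ.reg 0 = 1) ∧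
          (σ.reg 0 = 1 ↔ StrongStructControllable ℝ 𝒜 ℬ) ∧
          (σ.reg 0 = 1 ↔ StrongStructControllable ℂ 𝒜 ℬ) := by
  refine ⟨RAM.program, 59 + RAM.timeFactor, fun n r ν 𝒜 ℬ colPtr rowIdx hn hν hccs => ?_⟩
  subst hν
  obtain ⟨t, σ, hexec, htime, hbool, hiff⟩ :=
    RAM.exec_program_of_isCCS hccs hn (Nat.mul_le_mul_right _ (Nat.le_add_right 59 _))
  exact ⟨t, σ, hexec, htime.trans (Nat.mul_le_mul_right _ (Nat.le_add_left _ 59)), hbool,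
    hiff.trans (strongStructControllable_iff_peelable ℝ).symm,
    hiff.trans (strongStructControllable_iff_peelable ℂ).symm⟩
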